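/- Let $0<\alpha\le 1$, $\omega\ge 0$, $\sigma>0$, $\lambda>0$, $\varepsilon,A_0,\nu\in\mathbb R$ and $N\in\mathbb N$, and let $(\mathcal F_t)$ be a filtration on a probability space; $\langle\cdot\rangle$ denotes expectation. Let $(\xi_t)_{t\ge0}$ be symmetric dichotomous Markov noise: it has right-continuous paths with values in $\{\sigma,-\sigma\}$, is adapted to $(\mathcal F_t)$ and Markov with respect to it, and satisfies $\langle\xi_t\rangle=0$ and $\langle\xi_t\xi_\tau\rangle=\sigma^2e^{-\lambda|t-\tau|}$ for all $t,\tau\ge0$. Write $$D^\alpha x(t)=\frac1{\Gamma(1-\alpha)}\int_0^t(t-u)^{-\alpha}\dot x(u)\,du\quad(\alpha<1),\qquad D^1x=\dot x$$ for the Caputo derivative. Let $x_0$ (the main, or hub, particle) and $x_1,\dots,x_N$ (the general particles) be real $(\mathcal F_t)$-adapted processes on $[0,\infty)$ with integrable initial values $x_i(0)$ which, almost surely, have locally absolutely continuous paths and satisfy, for almost every $t>0$, the star-coupled system $$D^\alpha x_0+(\omega+\xi_t)x_0=\varepsilon\sum_{i=1}^N(x_i-x_0)+A_0\sin(\nu t),$$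 $$D^\alpha x_k+(\omega+\xi_t)x_k=\varepsilon(x_0-x_k)+A_0\sin(\nu t),\qquad k=1,\dots,N.$$ Let $S=\frac1{N+1}\sum_{i=0}^Nx_i$ be the mean field and $\Delta_0=x_0-S$ the deviation of the main particle from it. Then: 1. Almost surely, $\Delta_0$ has locally absolutely continuous paths and, for almost every $t>0$, $$D^\alpha\Delta_0+[\omega+\xi_t+\varepsilon(N+1)]\Delta_0=0.$$ 2. For every $t\ge0$ the random variables $x_0(t)$, $S(t)$ and $\Delta_0(t)$ are integrable. 3. If $\omega+\varepsilon(N+1)>0$ (for instance, if $\varepsilon>0$) and $$\sigma^2<[\omega+\varepsilon(N+1)]^2+\lambda^\alpha[\omega+\varepsilon(N+1)],$$ then $\langle\Delta_0(t)\rangle\to0$ as $t\to\infty$; that is, the main particle synchronizes in mean with the mean field. -/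

import Mathlib

open MeasureTheory ProbabilityTheory Filter Topology
open scoped BigOperators

/-- The Caputo derivative of order `α ∈ (0, 1]` with base point `0`:
`(1 / Γ(1 - α)) ∫₀ᵗ (t - u)^(-α) x'(u) du` for `α < 1`, and the ordinary derivative for `α = 1`
(the value to which the formula degenerates). It is meant for functions that are absolutely
continuous on bounded subintervals of `[0, ∞)`; for those the integral exists for almost every
`t > 0`. -/
noncomputable def caputoDeriv (α : ℝ) (x : ℝ → ℝ) (t : ℝ) : ℝ :=
  if α = 1 then deriv x t
  else (1 / Real.Gamma (1 - α)) * ∫ u in (0 : ℝ)..t, (t - u) ^ (-α) * deriv x u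

/-- `x` is absolutely continuous on every interval `[0, T]`. -/
def LocallyAC (x : ℝ → ℝ) : Prop :=
  ∀ T : ℝ, 0 < T → AbsolutelyContinuousOnInterval x 0 T

/-- Symmetric dichotomous Markov noise (random telegraph noise) with values `±σ` and correlation
rate `lam`, relative to a filtration `𝓕`. Time is the half-line `t ≥ 0`; nothing is said about
negative indices. Every path is right-continuous, so it keeps each value for a positive time. -/
structure IsTelegraphNoise {Ω : Type*} {mΩ : MeasurableSpace Ω} (P : Measure Ω)
    (𝓕 : Filtration ℝ mΩ) (σ lam : ℝ) (ξ : ℝ → Ω → ℝ) : Prop where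
  adapted : ∀ t : ℝ, 0 ≤ t → Measurable[𝓕 t] (ξ t)
  values : ∀ t : ℝ, 0 ≤ t → ∀ w : Ω, ξ t w = σ ∨ ξ t w = -σ
  rightContinuous : ∀ w : Ω, ∀ t : ℝ, 0 ≤ t → ContinuousWithinAt (fun s => ξ s w) (Set.Ici t) t
  markov : ∀ s t : ℝ, 0 ≤ s → s ≤ t → ∀ B : Set ℝ, MeasurableSet B →
    P⟦ξ t ⁻¹' B | 𝓕 s⟧ =ᵐ[P] P⟦ξ t ⁻¹' B | MeasurableSpace.comap (ξ s) inferInstance⟧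
  mean : ∀ t : ℝ, 0 ≤ t → ∫ w, ξ t w ∂P = 0
  correlation : ∀ s t : ℝ, 0 ≤ s → 0 ≤ t →
    ∫ w, ξ t w * ξ s w ∂P = σ ^ 2 * Real.exp (-lam * |t - s|)

/-- The processes `x 0` (the main particle) and `x 1, …, x N` (the general particles) form a
solution of the star-coupled fractional system with intrinsic frequency `ω`, noise `ξ`, coupling
coefficient `ε` and periodic force `A * sin (ν * t)`: they are nonanticipating, and almost surely
their paths are locally absolutely continuous and satisfy the equations for almost every time. -/
structure IsStarSolution {Ω : Type*} {mΩ : MeasurableSpace Ω} (P : Measure Ω)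
    (𝓕 : Filtration ℝ mΩ) (α ω ε A ν : ℝ) (ξ : ℝ → Ω → ℝ) (N : ℕ)
    (x : Fin (N + 1) → ℝ → Ω → ℝ) : Prop where
  adapted : ∀ i : Fin (N + 1), ∀ t : ℝ, 0 ≤ t → Measurable[𝓕 t] (x i t)
  locallyAC : ∀ᵐ w ∂P, ∀ i : Fin (N + 1), LocallyAC (fun t => x i t w)
  main_eq : ∀ᵐ w ∂P, ∀ᵐ t ∂(volume.restrict (Set.Ioi (0 : ℝ))),
    caputoDeriv α (fun s => x 0 s w) t + (ω + ξ t w) * x 0 t w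
      = ε * ∑ k : Fin N, (x k.succ t w - x 0 t w) + A * Real.sin (ν * t)
  general_eq : ∀ᵐ w ∂P, ∀ k : Fin N, ∀ᵐ t ∂(volume.restrict (Set.Ioi (0 : ℝ))),
    caputoDeriv α (fun s => x k.succ s w) t + (ω + ξ t w) * x k.succ t w
      = ε * (x 0 t w - x k.succ t w) + A * Real.sin (ν * t)

/-- The mean field `S = (x₀ + ⋯ + x_N) / (N + 1)`. -/
noncomputable def meanField {Ω : Type*} {N : ℕ} (x : Fin (N + 1) → ℝ → Ω → ℝ)
    (t : ℝ) (w : Ω) : ℝ :=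
  (∑ i : Fin (N + 1), x i t w) / ((N : ℝ) + 1)

/-- The deviation `Δ₀ = x₀ - S` of the main particle from the mean field. -/
noncomputable def mainDeviation {Ω : Type*} {N : ℕ} (x : Fin (N + 1) → ℝ → Ω → ℝ)
    (t : ℝ) (w : Ω) : ℝ :=
  x 0 t w - meanField x t w

/-! Put `a = ω + ε (N + 1)`. In the deviation `y` of the hub the common force cancels and the
coupling acts as multiplication by `-ε (N + 1)`, so `D^α y + (a + ξ) y = 0`. Fractional integration
turns this, path by path, into `y = y(0) - κ ∗ ((a + ξ) y)` with `κ = fracKernel α`.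

Averaging closes on the two moments `m = ⟨y⟩` and `q = ⟨ξ y⟩`. Since the noise is Markov with two
values, conditioning on the past up to `u` replaces `ξ_t` by `exp (-λ (t - u)) ξ_u`
(`IsTelegraphNoise.integral_mul`), and `ξ² = σ²` stops the hierarchy: `m = m(0) - κ ∗ (a m + q)` and
`q = exp (-λ t) q(0) - (exp (-λ ·) κ) ∗ (a q + σ² m)`.

Stability comes from the resolvent `r` of `a κ`. It is positive for positive times
(`resolventKernel_pos`) and has mass `1`, while `exp (-λ ·) r` has mass `a / (λ^α + a)`. Variation
of constants expresses `m` as a decaying term minus `(1 / a) r ∗ q`, and `q` as a decaying term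
minus `(σ² / a) (exp (-λ ·) r) ∗ m`. The loop from `m` through `q` back to `m` therefore has gain
`σ² / (a (λ^α + a))`, which is below `1` exactly under the stated condition. This gain bounds both
moments and, iterated on eventual bounds, forces `m → 0` (`tendsto_zero_of_moment_system`).

Expectations and Fubini require an integrable bound for the paths on `[0, T]`. A fractional Grönwall
inequality whose constant does not depend on the path bounds `∑ |x_i|` by an affine function of the
initial values; right-continuity gives joint measurability. -/

/-! ### Fractional kernels: semigroup, Laplace transform, growth in the order -/

/-- The fractional integration kernel `t ^ (β - 1) / Γ(β)`. -/
noncomputable def fracKernel (β t : ℝ) : ℝ := t ^ (β - 1) / Real.Gamma β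

lemma measurable_fracKernel (β : ℝ) : Measurable (fracKernel β) := by
  unfold fracKernel; fun_prop

lemma fracKernel_nonneg {β t : ℝ} (hβ : 0 < β) (ht : 0 ≤ t) : 0 ≤ fracKernel β t :=
  div_nonneg (Real.rpow_nonneg ht _) (Real.Gamma_pos_of_pos hβ).le

lemma fracKernel_pos {β t : ℝ} (hβ : 0 < β) (ht : 0 < t) : 0 < fracKernel β t :=
  div_pos (Real.rpow_pos_of_pos ht _) (Real.Gamma_pos_of_pos hβ)

lemma fracKernel_one (t : ℝ) : fracKernel 1 t = 1 := by simp [fracKernel]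

lemma continuousOn_fracKernel (β : ℝ) : ContinuousOn (fracKernel β) (Set.Ioi 0) := by
  refine ContinuousOn.div_const ?_ _
  exact fun t ht => (Real.continuousAt_rpow_const t _ (Or.inl (ne_of_gt ht))).continuousWithinAt

/-- The fractional kernels form a convolution semigroup. -/
lemma integral_fracKernel_mul {a b t : ℝ} (ha : 0 < a) (hb : 0 < b) (ht : 0 < t) :
    ∫ u in (0 : ℝ)..t, fracKernel a (t - u) * fracKernel b u = fracKernel (a + b) t := by
  have hbeta : ∫ u in (0 : ℝ)..t, u ^ (b - 1) * (t - u) ^ (a - 1)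
      = t ^ (b + a - 1) * beta b a := by
    -- The scaled Beta integral is complex; on `[0, t]` both bases are nonnegative, so the complex
    -- powers are real ones.
    have h := Complex.betaIntegral_scaled (b : ℂ) (a : ℂ) ht
    have h1 : ∫ x in (0 : ℝ)..t, (x : ℂ) ^ ((b : ℂ) - 1) * ((t : ℂ) - x) ^ ((a : ℂ) - 1)
        = ((∫ u in (0 : ℝ)..t, u ^ (b - 1) * (t - u) ^ (a - 1) : ℝ) : ℂ) := by
      rw [← intervalIntegral.integral_ofReal]
      refine intervalIntegral.integral_congr fun x hx => ?_
      rw [Set.uIcc_of_le ht.le] at hx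
      rw [Complex.ofReal_mul, Complex.ofReal_cpow hx.1, Complex.ofReal_cpow (sub_nonneg.2 hx.2)]
      push_cast; rfl
    rw [h1] at h
    have h2 := congrArg Complex.re h
    rw [Complex.ofReal_re] at h2
    rw [h2, beta_eq_betaIntegralReal b a hb ha]
    have h3 : (t : ℂ) ^ ((b : ℂ) + a - 1) = ((t ^ (b + a - 1) : ℝ) : ℂ) := by
      rw [Complex.ofReal_cpow ht.le]; push_cast; rfl
    rw [h3, Complex.re_ofReal_mul]
  have hΓa := (Real.Gamma_pos_of_pos ha).ne'
  have hΓb := (Real.Gamma_pos_of_pos hb).ne'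
  have hΓ := (Real.Gamma_pos_of_pos (add_pos ha hb)).ne'
  calc ∫ u in (0 : ℝ)..t, fracKernel a (t - u) * fracKernel b u
      = ∫ u in (0 : ℝ)..t,
          (1 / (Real.Gamma a * Real.Gamma b)) * (u ^ (b - 1) * (t - u) ^ (a - 1)) := by
        refine intervalIntegral.integral_congr fun x _ => ?_
        simp only [fracKernel]; field_simp
    _ = fracKernel (a + b) t := by
        rw [intervalIntegral.integral_const_mul, hbeta, fracKernel, beta, add_comm b a]
        field_simp

/-- A non-integrable function has integral `0` by convention, whereas the value computed above is
positive. -/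
lemma intervalIntegrable_fracKernel_mul {a b t : ℝ} (ha : 0 < a) (hb : 0 < b) (ht : 0 < t) :
    IntervalIntegrable (fun u => fracKernel a (t - u) * fracKernel b u) volume 0 t := by
  by_contra h
  have h1 := integral_fracKernel_mul ha hb ht
  rw [intervalIntegral.integral_undef h] at h1
  exact (fracKernel_pos (add_pos ha hb) ht).ne h1

lemma integral_exp_mul_fracKernel {β c : ℝ} (hβ : 0 < β) (hc : 0 < c) :
    ∫ t in Set.Ioi (0 : ℝ), Real.exp (-(c * t)) * fracKernel β t = (c ^ β)⁻¹ := by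
  have hΓ := (Real.Gamma_pos_of_pos hβ).ne'
  have h := Real.integral_rpow_mul_exp_neg_mul_Ioi hβ hc
  calc ∫ t in Set.Ioi (0 : ℝ), Real.exp (-(c * t)) * fracKernel β t
      = ∫ t in Set.Ioi (0 : ℝ), (1 / Real.Gamma β) * (t ^ (β - 1) * Real.exp (-(c * t))) := by
        congr 1; ext t; simp only [fracKernel]; ring
    _ = (c ^ β)⁻¹ := by
        rw [integral_const_mul, h, Real.div_rpow zero_le_one hc.le, Real.one_rpow]
        field_simp

lemma integrableOn_exp_mul_fracKernel {β c : ℝ} (hβ : 0 < β) (hc : 0 < c) :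
    IntegrableOn (fun t => Real.exp (-(c * t)) * fracKernel β t) (Set.Ioi 0) := by
  by_contra h
  have h1 := integral_exp_mul_fracKernel hβ hc
  rw [integral_undef h] at h1
  exact (inv_pos.2 (Real.rpow_pos_of_pos hc β)).ne h1

lemma integral_fracKernel {β t : ℝ} (hβ : 0 < β) (ht : 0 < t) :
    ∫ u in (0 : ℝ)..t, fracKernel β u = fracKernel (β + 1) t := by
  have h := integral_fracKernel_mul one_pos hβ ht
  simpa only [fracKernel_one, one_mul, add_comm (1 : ℝ)] using h

lemma intervalIntegrable_fracKernel {β t : ℝ} (hβ : 0 < β) (ht : 0 < t) :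
    IntervalIntegrable (fracKernel β) volume 0 t := by
  simpa only [fracKernel_one, one_mul] using intervalIntegrable_fracKernel_mul one_pos hβ ht

/-- A bound on the kernels that is geometric in the order. -/
lemma fracKernel_le {β t c : ℝ} (hβ : 0 < β) (ht : 0 < t) (hc : 0 < c) :
    fracKernel β t ≤ (c ^ β)⁻¹ * (Real.exp (c * (t + 1)) * ((t + 1) / t)) := by
  have hint := integrableOn_exp_mul_fracKernel hβ hc
  have hsub : Set.Ioc t (t + 1) ⊆ Set.Ioi 0 := fun u hu => lt_trans ht hu.1
  have h1 : ∫ u in Set.Ioc t (t + 1), Real.exp (-(c * u)) * fracKernel β u ≤ (c ^ β)⁻¹ := by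
    rw [← integral_exp_mul_fracKernel hβ hc]
    refine setIntegral_mono_set hint ?_ (LE.le.eventuallyLE hsub)
    filter_upwards [ae_restrict_mem measurableSet_Ioi] with u hu
    exact mul_nonneg (Real.exp_pos _).le (fracKernel_nonneg hβ (le_of_lt hu))
  -- The bound compares the Laplace integral with its part over `(t, t + 1]`. Since `β - 1 ≥ -1`,
  -- the kernel there falls below its value at `t` by at most the factor `t / (t + 1)`. No estimate
  -- of `Γ(β)` is needed.
  have h2 : Real.exp (-(c * (t + 1))) * (fracKernel β t * (t / (t + 1)))
      ≤ ∫ u in Set.Ioc t (t + 1), Real.exp (-(c * u)) * fracKernel β u := by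
    have h3 : ∫ u in Set.Ioc t (t + 1), Real.exp (-(c * (t + 1))) * (fracKernel β t * (t / (t + 1)))
        = Real.exp (-(c * (t + 1))) * (fracKernel β t * (t / (t + 1))) := by simp
    rw [← h3]
    refine setIntegral_mono_on (integrableOn_const (by simp)) (hint.mono_set hsub) measurableSet_Ioc fun u hu => ?_
    have hu0 : 0 < u := hsub hu
    refine mul_le_mul (Real.exp_le_exp.2 ?_) ?_ ?_ (Real.exp_pos _).le
    · have := mul_le_mul_of_nonneg_left hu.2 hc.le; linarith
    · have hΓ := Real.Gamma_pos_of_pos hβ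
      have h4 : fracKernel β u = fracKernel β t * (u / t) ^ (β - 1) := by
        rw [fracKernel, fracKernel, Real.div_rpow hu0.le ht.le]
        have := (Real.rpow_pos_of_pos ht (β - 1)).ne'
        field_simp
      rw [h4]
      refine mul_le_mul_of_nonneg_left ?_ (fracKernel_nonneg hβ ht.le)
      have h5 : 1 ≤ u / t := (one_le_div ht).2 hu.1.le
      calc t / (t + 1) ≤ (u / t)⁻¹ := by
            rw [inv_div]; exact div_le_div_of_nonneg_left ht.le hu0 hu.2
        _ = (u / t) ^ (-1 : ℝ) := (Real.rpow_neg_one _).symm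
        _ ≤ (u / t) ^ (β - 1) := Real.rpow_le_rpow_of_exponent_le h5 (by linarith)
    · exact mul_nonneg (fracKernel_nonneg hβ ht.le) (by positivity)
  have h6 := h2.trans h1
  have h7 : fracKernel β t = Real.exp (-(c * (t + 1))) * (fracKernel β t * (t / (t + 1)))
      * (Real.exp (c * (t + 1)) * ((t + 1) / t)) := by
    have : Real.exp (-(c * (t + 1))) * Real.exp (c * (t + 1)) = 1 := by
      rw [← Real.exp_add]; simp
    calc fracKernel β t = (Real.exp (-(c * (t + 1))) * Real.exp (c * (t + 1))) *
          (fracKernel β t * (t / (t + 1)) * ((t + 1) / t)) := by rw [this]; field_simp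
      _ = _ := by ring
  rw [h7]
  exact mul_le_mul_of_nonneg_right h6 (by positivity)

/-! ### Volterra convolutions and Fubini on a triangle -/

/-- The integrand of an iterated Volterra convolution, supported on the triangle `v < u`. -/
noncomputable def triangleIntegrand (f g h : ℝ → ℝ) (t : ℝ) (p : ℝ × ℝ) : ℝ :=
  Set.indicator {p : ℝ × ℝ | p.2 < p.1} (fun p => f (t - p.1) * g (p.1 - p.2) * h p.2) p

section Triangle

variable {f g h c : ℝ → ℝ} {t : ℝ}

lemma aestronglyMeasurable_triangleIntegrand (hf : Measurable f) (hg : Measurable g)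
    (hh : AEStronglyMeasurable h (volume.restrict (Set.Ioc 0 t))) :
    AEStronglyMeasurable (triangleIntegrand f g h t)
      ((volume.restrict (Set.Ioc 0 t)).prod (volume.restrict (Set.Ioc 0 t))) := by
  have h1 : Measurable fun p : ℝ × ℝ => f (t - p.1) * g (p.1 - p.2) := by fun_prop
  have h2 : AEStronglyMeasurable (fun p : ℝ × ℝ => h p.2)
      ((volume.restrict (Set.Ioc 0 t)).prod (volume.restrict (Set.Ioc 0 t))) := hh.comp_snd
  exact (h1.aestronglyMeasurable.mul h2).indicator (measurableSet_lt measurable_snd measurable_fst)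

lemma triangleIntegrand_section_left {v : ℝ} (u : ℝ) :
    triangleIntegrand f g h t (u, v)
      = (Set.Ioi v).indicator (fun u => f (t - u) * g (u - v) * h v) u := by
  simp [triangleIntegrand, Set.indicator_apply]

lemma triangleIntegrand_section_right {u : ℝ} (v : ℝ) :
    triangleIntegrand f g h t (u, v)
      = (Set.Iio u).indicator (fun v => f (t - u) * g (u - v) * h v) v := by
  simp [triangleIntegrand, Set.indicator_apply]

lemma intervalIntegrable_shift {v : ℝ}
    (hi : IntervalIntegrable (fun u => f (t - v - u) * g u) volume 0 (t - v)) :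
    IntervalIntegrable (fun u => f (t - u) * g (u - v)) volume v t := by
  have := hi.comp_sub_right v
  simpa using this

lemma integral_shift (v : ℝ) :
    ∫ u in v..t, f (t - u) * g (u - v) = ∫ u in (0 : ℝ)..(t - v), f (t - v - u) * g u := by
  have := intervalIntegral.integral_comp_sub_right (a := v) (b := t)
    (fun u => f (t - v - u) * g u) v
  simpa using this

lemma integrable_triangleIntegrand_section {v : ℝ} (hv : v ∈ Set.Ioo 0 t)
    (hi : IntervalIntegrable (fun u => f (t - v - u) * g u) volume 0 (t - v)) :
    Integrable (fun u => triangleIntegrand f g h t (u, v)) (volume.restrict (Set.Ioc 0 t)) := by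
  simp_rw [triangleIntegrand_section_left]
  rw [integrable_indicator_iff measurableSet_Ioi, IntegrableOn,
    Measure.restrict_restrict measurableSet_Ioi]
  have h1 := (intervalIntegrable_iff_integrableOn_Ioc_of_le hv.2.le).1 (intervalIntegrable_shift hi)
  have h2 : Set.Ioi v ∩ Set.Ioc 0 t = Set.Ioc v t := by
    ext u; simp only [Set.mem_inter_iff, Set.mem_Ioi, Set.mem_Ioc]
    exact ⟨fun h => ⟨h.1, h.2.2⟩, fun h => ⟨h.1, hv.1.trans h.1, h.2⟩⟩
  rw [h2]
  exact Integrable.mul_const h1 (h v)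

lemma integral_triangleIntegrand_section {v : ℝ} (hv : v ∈ Set.Ioo 0 t) :
    ∫ u in Set.Ioc 0 t, triangleIntegrand f g h t (u, v)
      = (∫ u in (0 : ℝ)..(t - v), f (t - v - u) * g u) * h v := by
  simp_rw [triangleIntegrand_section_left]
  have h2 : Set.Ioc 0 t ∩ Set.Ioi v = Set.Ioc v t := by
    ext u; simp only [Set.mem_inter_iff, Set.mem_Ioi, Set.mem_Ioc]
    exact ⟨fun h => ⟨h.2, h.1.2⟩, fun h => ⟨⟨hv.1.trans h.1, h.2⟩, h.1⟩⟩
  rw [setIntegral_indicator measurableSet_Ioi, h2, integral_mul_const, ← integral_shift,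
    intervalIntegral.integral_of_le hv.2.le]

lemma norm_triangleIntegrand (hf0 : ∀ s, 0 < s → 0 ≤ f s) (hg0 : ∀ s, 0 < s → 0 ≤ g s)
    {u v : ℝ} (hu : u < t) :
    ‖triangleIntegrand f g h t (u, v)‖ = triangleIntegrand f g (fun v => |h v|) t (u, v) := by
  simp only [triangleIntegrand, Set.indicator_apply, Set.mem_ofPred_eq]
  split_ifs with hvu
  · rw [Real.norm_eq_abs, abs_mul, abs_mul, abs_of_nonneg (hf0 _ (sub_pos.2 hu)),
      abs_of_nonneg (hg0 _ (sub_pos.2 hvu))]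
  · simp

lemma ae_mem_Ioo_of_restrict_Ioc (t : ℝ) :
    ∀ᵐ v ∂(volume.restrict (Set.Ioc 0 t)), v ∈ Set.Ioo 0 t := by
  rw [← restrict_Ioo_eq_restrict_Ioc]
  exact ae_restrict_mem measurableSet_Ioo

variable (hf : Measurable f) (hg : Measurable g)
    (hf0 : ∀ s, 0 < s → 0 ≤ f s) (hg0 : ∀ s, 0 < s → 0 ≤ g s)
    (hh : AEStronglyMeasurable h (volume.restrict (Set.Ioc 0 t)))
    (hfg : ∀ s, 0 < s → s < t → IntervalIntegrable (fun u => f (s - u) * g u) volume 0 s)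
    (hfgc : ∀ s, 0 < s → s < t → ∫ u in (0 : ℝ)..s, f (s - u) * g u = c s)
    (hc : IntegrableOn (fun v => c (t - v) * h v) (Set.Ioc 0 t))

include hf hg hf0 hg0 hh hfg hfgc hc

/-- Tonelli: the kernels are nonnegative, so integrating the absolute value in `u` leaves `c (t - v)
|h v|`, which is integrable by assumption. -/
lemma integrable_triangleIntegrand :
    Integrable (triangleIntegrand f g h t)
      ((volume.restrict (Set.Ioc 0 t)).prod (volume.restrict (Set.Ioc 0 t))) := by
  rw [integrable_prod_iff' (aestronglyMeasurable_triangleIntegrand hf hg hh)]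
  constructor
  · filter_upwards [ae_mem_Ioo_of_restrict_Ioc t] with v hv
    exact integrable_triangleIntegrand_section hv (hfg _ (sub_pos.2 hv.2) (by linarith [hv.1]))
  · refine hc.norm.congr ?_
    filter_upwards [ae_mem_Ioo_of_restrict_Ioc t] with v hv
    have h0 : 0 < t - v := sub_pos.2 hv.2
    have h1 : t - v < t := by linarith [hv.1]
    have h2 : ∫ u in Set.Ioc 0 t, ‖triangleIntegrand f g h t (u, v)‖
        = ∫ u in Set.Ioc 0 t, triangleIntegrand f g (fun v => |h v|) t (u, v) := by
      refine integral_congr_ae ?_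
      filter_upwards [ae_mem_Ioo_of_restrict_Ioc t] with u hu
      exact norm_triangleIntegrand hf0 hg0 hu.2
    rw [h2, integral_triangleIntegrand_section hv, hfgc _ h0 h1]
    have h3 : 0 ≤ c (t - v) := by
      rw [← hfgc _ h0 h1, intervalIntegral.integral_of_le h0.le, integral_Ioc_eq_integral_Ioo]
      refine setIntegral_nonneg measurableSet_Ioo fun u hu => ?_
      exact mul_nonneg (hf0 _ (sub_pos.2 hu.2)) (hg0 _ hu.1)
    rw [Real.norm_eq_abs, abs_mul, abs_of_nonneg h3]

/-- Associativity of Volterra convolution for nonnegative kernels. -/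
lemma integral_volterra_assoc (ht : 0 ≤ t) :
    ∫ u in (0 : ℝ)..t, f (t - u) * ∫ v in (0 : ℝ)..u, g (u - v) * h v
      = ∫ v in (0 : ℝ)..t, c (t - v) * h v := by
  have hint := integrable_triangleIntegrand hf hg hf0 hg0 hh hfg hfgc hc
  have hswap := integral_integral_swap (f := fun u v => triangleIntegrand f g h t (u, v)) hint
  rw [intervalIntegral.integral_of_le ht, intervalIntegral.integral_of_le ht]
  have h1 : ∫ v in Set.Ioc 0 t, c (t - v) * h v
      = ∫ v in Set.Ioc 0 t, ∫ u in Set.Ioc 0 t, triangleIntegrand f g h t (u, v) := by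
    refine integral_congr_ae ?_
    filter_upwards [ae_mem_Ioo_of_restrict_Ioc t] with v hv
    rw [integral_triangleIntegrand_section hv, hfgc _ (sub_pos.2 hv.2) (by linarith [hv.1])]
  rw [h1, ← hswap]
  refine setIntegral_congr_fun measurableSet_Ioc fun u hu => ?_
  simp_rw [triangleIntegrand_section_right]
  have h2 : Set.Ioc 0 t ∩ Set.Iio u = Set.Ioo 0 u := by
    ext v; simp only [Set.mem_inter_iff, Set.mem_Iio, Set.mem_Ioc, Set.mem_Ioo]
    exact ⟨fun h => ⟨h.1.1, h.2⟩, fun h => ⟨⟨h.1, h.2.le.trans hu.2⟩, h.2⟩⟩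
  rw [setIntegral_indicator measurableSet_Iio, h2, ← integral_Ioc_eq_integral_Ioo,
    intervalIntegral.integral_of_le hu.1.le, ← integral_const_mul]
  simp only [mul_assoc]

/-- Fubini makes almost every section integrable, and the constant factor `f (t - u)` can be divided
out. This is what makes Caputo integrals converge at almost every time. -/
lemma ae_integrable_volterra (hfpos : ∀ s, 0 < s → f s ≠ 0) :
    ∀ᵐ u ∂(volume.restrict (Set.Ioc 0 t)),
      IntervalIntegrable (fun v => g (u - v) * h v) volume 0 u := by
  have hint := integrable_triangleIntegrand hf hg hf0 hg0 hh hfg hfgc hc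
  filter_upwards [hint.prod_right_ae, ae_mem_Ioo_of_restrict_Ioc t] with u hu hut
  simp_rw [triangleIntegrand_section_right] at hu
  rw [integrable_indicator_iff measurableSet_Iio, IntegrableOn,
    Measure.restrict_restrict measurableSet_Iio] at hu
  have h2 : Set.Iio u ∩ Set.Ioc 0 t = Set.Ioo 0 u := by
    ext v; simp only [Set.mem_inter_iff, Set.mem_Iio, Set.mem_Ioc, Set.mem_Ioo]
    exact ⟨fun h => ⟨h.2.1, h.1⟩, fun h => ⟨h.2, h.1, h.2.le.trans hut.2.le⟩⟩
  rw [h2] at hu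
  rw [intervalIntegrable_iff_integrableOn_Ioo_of_le hut.1.le]
  have h3 := hu.const_mul (f (t - u))⁻¹
  refine h3.congr (Eventually.of_forall fun v => ?_)
  have := hfpos _ (sub_pos.2 hut.2)
  field_simp

end Triangle

/-! ### The resolvent series: convergence, continuity, resolvent equation -/

/-- The summands of the resolvent of `a • fracKernel α`. -/
noncomputable def resolventTerm (α a : ℝ) (n : ℕ) (t : ℝ) : ℝ :=
  (-1) ^ n * a ^ (n + 1) * fracKernel (α * (n + 1)) t

/-- The resolvent of the kernel `a • fracKernel α` on the positive half-line: the function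
`a t ^ (α - 1) E_{α,α}(-a t ^ α)`, with `E` the Mittag-Leffler function. -/
noncomputable def resolventKernel (α a : ℝ) : ℝ → ℝ :=
  (Set.Ioi 0).indicator fun t => ∑' n, resolventTerm α a n t

section Resolvent

variable {α a : ℝ}

lemma resolventKernel_of_pos {t : ℝ} (ht : 0 < t) :
    resolventKernel α a t = ∑' n, resolventTerm α a n t :=
  Set.indicator_of_mem (s := Set.Ioi (0 : ℝ)) ht _

lemma order_pos (hα : 0 < α) (n : ℕ) : 0 < α * ((n : ℝ) + 1) := by positivity

lemma abs_resolventTerm (hα : 0 < α) (ha : 0 < a) (n : ℕ) {t : ℝ} (ht : 0 ≤ t) :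
    |resolventTerm α a n t| = a ^ (n + 1) * fracKernel (α * (n + 1)) t := by
  rw [resolventTerm, abs_mul, abs_mul, abs_pow, abs_neg, abs_one, one_pow, one_mul,
    abs_of_pos (pow_pos ha _), abs_of_nonneg (fracKernel_nonneg (order_pos hα n) ht)]

lemma exists_abs_resolventTerm_le (hα : 0 < α) (ha : 0 < a) :
    ∃ c : ℝ, 0 < c ∧ ∀ (n : ℕ) (t : ℝ), 0 < t →
      |resolventTerm α a n t| ≤ (1 / 2) ^ (n + 1) * (Real.exp (c * (t + 1)) * ((t + 1) / t)) := by
  -- This `c` satisfies `c ^ α = 2 a`, so order `α (n + 1)` contributes `(2 a) ^ (n + 1)` in the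
  -- denominator, against `a ^ (n + 1)` in the coefficient.
  have hc : 0 < (2 * a) ^ α⁻¹ := Real.rpow_pos_of_pos (by positivity) _
  refine ⟨(2 * a) ^ α⁻¹, hc, fun n t ht => ?_⟩
  rw [abs_resolventTerm hα ha n ht.le]
  have h := fracKernel_le (order_pos hα n) ht hc
  have h1 : ((2 * a) ^ α⁻¹) ^ (α * ((n : ℝ) + 1)) = (2 * a) ^ (n + 1) := by
    rw [← Real.rpow_mul (by positivity), inv_mul_cancel_left₀ hα.ne', ← Real.rpow_natCast]
    push_cast; rfl
  rw [h1] at h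
  calc a ^ (n + 1) * fracKernel (α * (n + 1)) t
      ≤ a ^ (n + 1) * (((2 * a) ^ (n + 1))⁻¹ *
          (Real.exp ((2 * a) ^ α⁻¹ * (t + 1)) * ((t + 1) / t))) :=
        mul_le_mul_of_nonneg_left h (by positivity)
    _ = _ := by
        rw [← mul_assoc]
        congr 1
        rw [mul_pow, one_div, inv_pow]
        field_simp

lemma summable_half_pow : Summable fun n : ℕ => (1 / 2 : ℝ) ^ (n + 1) :=
  (summable_nat_add_iff 1).2 (summable_geometric_of_lt_one (by norm_num) (by norm_num))

lemma summable_abs_resolventTerm (hα : 0 < α) (ha : 0 < a) {t : ℝ} (ht : 0 < t) :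
    Summable fun n => |resolventTerm α a n t| := by
  obtain ⟨c, -, hc⟩ := exists_abs_resolventTerm_le hα ha
  exact Summable.of_nonneg_of_le (fun n => abs_nonneg _) (fun n => hc n t ht)
    (summable_half_pow.mul_right _)

/-- The bound on the terms blows up at `0` and at infinity; dividing by its `t`-dependent factor `E`
makes the Weierstrass test uniform on the whole half-line. -/
lemma continuousOn_resolventKernel (hα : 0 < α) (ha : 0 < a) :
    ContinuousOn (resolventKernel α a) (Set.Ioi 0) := by
  obtain ⟨c, -, hc⟩ := exists_abs_resolventTerm_le hα ha
  set E : ℝ → ℝ := fun t => Real.exp (c * (t + 1)) * ((t + 1) / t) with hE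
  have hEpos : ∀ t : ℝ, 0 < t → 0 < E t := fun t ht => by simp only [hE]; positivity
  have hEc : ContinuousOn E (Set.Ioi 0) := by
    refine ContinuousOn.mul (by fun_prop) (ContinuousOn.div (by fun_prop) (by fun_prop) ?_)
    exact fun t ht => ne_of_gt ht
  have h1 : ContinuousOn (fun t => ∑' n, resolventTerm α a n t / E t) (Set.Ioi 0) := by
    refine continuousOn_tsum (fun n => ?_) summable_half_pow fun n t ht => ?_
    · exact ((continuousOn_fracKernel _).const_mul _).div hEc fun t ht => (hEpos t ht).ne'
    · rw [Real.norm_eq_abs, abs_div, abs_of_pos (hEpos t ht), div_le_iff₀ (hEpos t ht)]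
      exact hc n t ht
  refine (hEc.mul h1).congr fun t ht => ?_
  rw [resolventKernel_of_pos ht, Pi.mul_apply, tsum_div_const]
  have := (hEpos t ht).ne'
  field_simp

lemma measurable_resolventKernel (hα : 0 < α) (ha : 0 < a) : Measurable (resolventKernel α a) := by
  classical
  have h := ContinuousOn.measurable_piecewise (continuousOn_resolventKernel hα ha)
    (continuousOn_const (c := (0 : ℝ))) measurableSet_Ioi
  convert h using 1
  ext t
  by_cases ht : t ∈ Set.Ioi (0 : ℝ) <;> simp [resolventKernel, Set.piecewise, ht]

lemma fracKernel_le_mul {β γ t T : ℝ} (hβ : 0 < β) (hγβ : γ ≤ β) (ht : 0 < t) (htT : t ≤ T) :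
    fracKernel β t ≤ (t / T) ^ (γ - 1) * fracKernel β T := by
  have hT := ht.trans_le htT
  have h1 : fracKernel β t = (t / T) ^ (β - 1) * fracKernel β T := by
    rw [fracKernel, fracKernel, Real.div_rpow ht.le hT.le]
    have := (Real.rpow_pos_of_pos hT (β - 1)).ne'
    field_simp
  rw [h1]
  refine mul_le_mul_of_nonneg_right ?_ (fracKernel_nonneg hβ hT.le)
  exact Real.rpow_le_rpow_of_exponent_ge (div_pos ht hT) ((div_le_one hT).2 htT) (by linarith)

lemma abs_tsum_le_of_abs_le {f g : ℕ → ℝ} (hf : Summable fun n => |f n|)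
    (h : ∀ n, |f n| ≤ g n) (hg : Summable g) : |∑' n, f n| ≤ ∑' n, g n := by
  have h1 := norm_tsum_le_tsum_norm (f := f) (by simpa only [Real.norm_eq_abs] using hf)
  simp only [Real.norm_eq_abs] at h1
  exact h1.trans (Summable.tsum_le_tsum h hf hg)

/-- Every term has order at least `α`, so passing from `T` to `t ≤ T` costs at most `(t / T) ^ (α -
1)`. This controls the singularity at `0` before the sign of the resolvent is known. -/
lemma abs_resolventKernel_le (hα : 0 < α) (ha : 0 < a) {t T : ℝ} (ht : 0 < t) (htT : t ≤ T) :
    |resolventKernel α a t| ≤ (t / T) ^ (α - 1) * ∑' n, |resolventTerm α a n T| := by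
  have hT := ht.trans_le htT
  have hs := summable_abs_resolventTerm hα ha ht
  rw [resolventKernel_of_pos ht, ← tsum_mul_left]
  refine abs_tsum_le_of_abs_le hs (fun n => ?_) ((summable_abs_resolventTerm hα ha hT).mul_left _)
  rw [abs_resolventTerm hα ha n ht.le, abs_resolventTerm hα ha n hT.le]
  have h := fracKernel_le_mul (order_pos hα n) (γ := α)
    (le_mul_of_one_le_right hα.le (by linarith [Nat.cast_nonneg (α := ℝ) n])) ht htT
  calc a ^ (n + 1) * fracKernel (α * (n + 1)) t
      ≤ a ^ (n + 1) * ((t / T) ^ (α - 1) * fracKernel (α * (n + 1)) T) :=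
        mul_le_mul_of_nonneg_left h (by positivity)
    _ = _ := by ring

/-- After the leading term all orders are at least `2 α`, so near `0` the remainder is small
compared with `a * fracKernel α t`. -/
lemma abs_resolventKernel_sub_le (hα : 0 < α) (ha : 0 < a) {t : ℝ} (ht : 0 < t) (ht1 : t ≤ 1) :
    |resolventKernel α a t - a * fracKernel α t|
      ≤ t ^ (2 * α - 1) * ∑' n, |resolventTerm α a (n + 1) 1| := by
  have hs := summable_abs_resolventTerm hα ha ht
  have hs1 := summable_abs_resolventTerm hα ha one_pos
  have h0 : resolventKernel α a t - a * fracKernel α t = ∑' n, resolventTerm α a (n + 1) t := by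
    rw [resolventKernel_of_pos ht, hs.of_abs.tsum_eq_zero_add]
    simp [resolventTerm]
  rw [h0, ← tsum_mul_left]
  have hs' := (summable_nat_add_iff 1).2 hs
  refine abs_tsum_le_of_abs_le hs' (fun n => ?_) (((summable_nat_add_iff 1).2 hs1).mul_left _)
  rw [abs_resolventTerm hα ha _ ht.le, abs_resolventTerm hα ha _ zero_le_one]
  have h := fracKernel_le_mul (order_pos hα (n + 1)) (γ := 2 * α)
    (by push_cast; nlinarith [Nat.cast_nonneg (α := ℝ) n]) ht ht1
  rw [div_one] at h
  calc a ^ (n + 1 + 1) * fracKernel (α * ((n + 1 : ℕ) + 1)) t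
      ≤ a ^ (n + 1 + 1) * (t ^ (2 * α - 1) * fracKernel (α * ((n + 1 : ℕ) + 1)) 1) :=
        mul_le_mul_of_nonneg_left h (by positivity)
    _ = _ := by ring

lemma intervalIntegrable_fracKernel_mul_resolventKernel (hα : 0 < α) (ha : 0 < a) {t : ℝ}
    (ht : 0 < t) :
    IntervalIntegrable (fun u => fracKernel α (t - u) * resolventKernel α a u) volume 0 t := by
  set C := ∑' n, |resolventTerm α a n t|
  have h1 := (intervalIntegrable_fracKernel_mul hα hα ht).const_mul
    ((Real.Gamma α / t ^ (α - 1)) * C)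
  rw [intervalIntegrable_iff_integrableOn_Ioo_of_le ht.le] at h1 ⊢
  refine Integrable.mono' h1 ?_ ?_
  · exact (((measurable_fracKernel α).comp (measurable_const.sub measurable_id)).mul
      (measurable_resolventKernel hα ha)).aestronglyMeasurable
  · filter_upwards [ae_restrict_mem measurableSet_Ioo] with u hu
    have h2 := abs_resolventKernel_le hα ha hu.1 hu.2.le
    have h3 := fracKernel_nonneg hα (sub_nonneg.2 hu.2.le)
    rw [norm_mul, Real.norm_eq_abs, Real.norm_eq_abs, abs_of_nonneg h3]
    refine (mul_le_mul_of_nonneg_left h2 h3).trans (le_of_eq ?_)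
    rw [Real.div_rpow hu.1.le ht.le]
    have hΓ := (Real.Gamma_pos_of_pos hα).ne'
    have h5 : fracKernel α u * Real.Gamma α = u ^ (α - 1) := by
      rw [fracKernel]; field_simp
    rw [← h5]
    ring

/-- The resolvent equation. -/
lemma resolventKernel_add_integral (hα : 0 < α) (ha : 0 < a) {t : ℝ} (ht : 0 < t) :
    resolventKernel α a t + a * ∫ u in (0 : ℝ)..t, fracKernel α (t - u) * resolventKernel α a u
      = a * fracKernel α t := by
  have hs := summable_abs_resolventTerm hα ha ht
  have hs' := (summable_nat_add_iff 1).2 hs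
  -- By the semigroup property, convolution with the kernel shifts the series by one index, up to
  -- the factor `-1 / a`; the sum then telescopes to its term of index `0`.
  have hterm : ∀ n, ∫ u in Set.Ioc 0 t, fracKernel α (t - u) * resolventTerm α a n u
      = -(1 / a) * resolventTerm α a (n + 1) t := by
    intro n
    have h := integral_fracKernel_mul hα (order_pos hα n) ht
    rw [intervalIntegral.integral_of_le ht.le] at h
    have h1 : ∀ u, fracKernel α (t - u) * resolventTerm α a n u = ((-1) ^ n * a ^ (n + 1)) *
        (fracKernel α (t - u) * fracKernel (α * (n + 1)) u) := fun u => by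
      rw [resolventTerm]; ring
    simp_rw [h1]
    rw [integral_const_mul, h, resolventTerm]
    have h2 : α + α * ((n : ℝ) + 1) = α * (((n + 1 : ℕ) : ℝ) + 1) := by push_cast; ring
    rw [h2, pow_succ (-1 : ℝ) n, pow_succ a (n + 1)]
    field_simp
  have hint : ∀ n, Integrable (fun u => fracKernel α (t - u) * resolventTerm α a n u)
      (volume.restrict (Set.Ioc 0 t)) := by
    intro n
    have h := (intervalIntegrable_iff_integrableOn_Ioc_of_le ht.le).1
      (intervalIntegrable_fracKernel_mul hα (order_pos hα n) ht)
    refine (h.const_mul ((-1) ^ n * a ^ (n + 1))).congr (Eventually.of_forall fun u => ?_)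
    simp only [resolventTerm]; ring
  have hnorm : ∀ n, ∫ u in Set.Ioc 0 t, ‖fracKernel α (t - u) * resolventTerm α a n u‖
      = (1 / a) * |resolventTerm α a (n + 1) t| := by
    intro n
    have h1 : ∫ u in Set.Ioc 0 t, ‖fracKernel α (t - u) * resolventTerm α a n u‖
        = ∫ u in Set.Ioc 0 t, (-1) ^ n * (fracKernel α (t - u) * resolventTerm α a n u) := by
      refine setIntegral_congr_fun measurableSet_Ioc fun u hu => ?_
      rw [norm_mul, Real.norm_eq_abs, Real.norm_eq_abs, abs_resolventTerm hα ha n hu.1.le,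
        abs_of_nonneg (fracKernel_nonneg hα (sub_nonneg.2 hu.2)), resolventTerm]
      have : ((-1 : ℝ) ^ n) * (-1) ^ n = 1 := by rw [← mul_pow]; simp
      linear_combination (-(fracKernel α (t - u)) * a ^ (n + 1) * fracKernel (α * (n + 1)) u) * this
    rw [h1, integral_const_mul, hterm, abs_resolventTerm hα ha _ ht.le, resolventTerm]
    have : ((-1 : ℝ) ^ n) * (-1) ^ n = 1 := by rw [← mul_pow]; simp
    rw [pow_succ (-1 : ℝ) n]
    linear_combination
      (1 / a * a ^ (n + 1 + 1) * fracKernel (α * ((n + 1 : ℕ) + 1)) t) * this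
  have hsum := hasSum_integral_of_summable_integral_norm hint
    (by simp_rw [hnorm]; exact hs'.mul_left _)
  simp_rw [hterm] at hsum
  have h2 : ∫ u in (0 : ℝ)..t, fracKernel α (t - u) * resolventKernel α a u
      = ∫ u in Set.Ioc 0 t, ∑' n, fracKernel α (t - u) * resolventTerm α a n u := by
    rw [intervalIntegral.integral_of_le ht.le]
    refine setIntegral_congr_fun measurableSet_Ioc fun u hu => ?_
    rw [resolventKernel_of_pos hu.1, tsum_mul_left]
  rw [h2, ← hsum.tsum_eq, tsum_mul_left, resolventKernel_of_pos ht,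
    hs.of_abs.tsum_eq_zero_add]
  have h3 : resolventTerm α a 0 t = a * fracKernel α t := by simp [resolventTerm]
  rw [h3]
  field_simp
  ring

end Resolvent

/-! ### Positivity and Laplace transform of the resolvent -/

section ResolventSign

variable {α a : ℝ}

/-- The exponent `α - 1` is nonpositive, so the claim reduces to `(t - s) t₀ ≤ (t₀ - s) t`, that is,
`s t ≤ s t₀`. -/
lemma fracKernel_ratio_le (hα : 0 < α) (hα1 : α ≤ 1) {s t t₀ : ℝ} (hs : 0 ≤ s) (hst : s < t)
    (htt : t ≤ t₀) :
    fracKernel α (t₀ - s) * fracKernel α t ≤ fracKernel α (t - s) * fracKernel α t₀ := by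
  have ht : 0 < t := hs.trans_lt hst
  have ht₀ : 0 < t₀ := ht.trans_le htt
  have hΓ := Real.Gamma_pos_of_pos hα
  have h1 : (t₀ - s) ^ (α - 1) * t ^ (α - 1) ≤ (t - s) ^ (α - 1) * t₀ ^ (α - 1) := by
    rw [← Real.mul_rpow (by linarith) ht.le, ← Real.mul_rpow (by linarith) ht₀.le]
    refine Real.rpow_le_rpow_of_nonpos (mul_pos (by linarith) ht₀) ?_ (by linarith)
    nlinarith
  simp only [fracKernel, div_mul_div_comm]
  gcongr

lemma fracKernel_antitone (hα : 0 < α) (hα1 : α ≤ 1) {s t : ℝ} (hs : 0 < s) (hst : s ≤ t) :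
    fracKernel α t ≤ fracKernel α s := by
  have hΓ := Real.Gamma_pos_of_pos hα
  simp only [fracKernel]
  gcongr 1
  exact Real.rpow_le_rpow_of_nonpos hs hst (by linarith)

lemma exists_resolventKernel_pos (hα : 0 < α) (ha : 0 < a) :
    ∃ δ : ℝ, 0 < δ ∧ ∀ t, 0 < t → t < δ → 0 < resolventKernel α a t := by
  set C := ∑' n, |resolventTerm α a (n + 1) 1|
  have hΓ := Real.Gamma_pos_of_pos hα
  have h0 : Tendsto (fun t : ℝ => t ^ α * C) (𝓝 0) (𝓝 0) := by
    have := (Real.continuousAt_rpow_const 0 α (Or.inr hα.le)).tendsto.mul_const C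
    simpa [Real.zero_rpow hα.ne'] using this
  have h1 := h0.eventually_lt_const (div_pos ha hΓ)
  obtain ⟨δ, hδ, hδ'⟩ := Metric.eventually_nhds_iff.1 h1
  refine ⟨min δ 1, lt_min hδ one_pos, fun t ht htδ => ?_⟩
  have h2 := abs_resolventKernel_sub_le hα ha ht (htδ.le.trans (min_le_right _ _))
  have h3 : t ^ α * C < a / Real.Gamma α :=
    hδ' (by rw [Real.dist_eq, sub_zero, abs_of_pos ht]; exact htδ.trans_le (min_le_left _ _))
  have h4 : t ^ (2 * α - 1) * C < a * fracKernel α t := by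
    have h5 : t ^ (2 * α - 1) = t ^ (α - 1) * t ^ α := by
      rw [← Real.rpow_add ht]; congr 1; ring
    have h6 : a * fracKernel α t = t ^ (α - 1) * (a / Real.Gamma α) := by
      rw [fracKernel]; ring
    rw [h5, h6, mul_assoc]
    exact mul_lt_mul_of_pos_left h3 (Real.rpow_pos_of_pos ht _)
  have := (abs_le.1 h2).1
  linarith

/-- The resolvent is positive: at a first zero `t₀` one compares the resolvent equation there
with the equation at a maximiser over a short interval to the left of `t₀`. -/
lemma resolventKernel_pos (hα : 0 < α) (hα1 : α ≤ 1) (ha : 0 < a) {t : ℝ} (ht : 0 < t) :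
    0 < resolventKernel α a t := by
  by_contra hneg
  rw [not_lt] at hneg
  obtain ⟨δ, hδ, hδpos⟩ := exists_resolventKernel_pos (α := α) (a := a) hα ha
  have hcont := continuousOn_resolventKernel hα ha
  set r := resolventKernel α a with hr
  set Z : Set ℝ := Set.Ici δ ∩ r ⁻¹' Set.Iic 0 with hZ
  -- Cutting off `(0, δ)`, where positivity is known, keeps the zero set away from the singularity,
  -- so it is closed and its infimum is attained.
  have hZc : IsClosed Z :=
    (hcont.mono fun s hs => lt_of_lt_of_le hδ hs).preimage_isClosed_of_isClosed
      isClosed_Ici isClosed_Iic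
  have htZ : t ∈ Z := by
    refine ⟨?_, hneg⟩
    by_contra h
    exact absurd (hδpos t ht (not_le.1 h)) (not_lt.2 hneg)
  have hbdd : BddBelow Z := ⟨δ, fun s hs => hs.1⟩
  obtain ⟨hδt₀, hrt₀⟩ := hZc.csInf_mem ⟨t, htZ⟩ hbdd
  set t₀ := sInf Z
  have hrt₀ : r t₀ ≤ 0 := hrt₀
  have ht₀ : 0 < t₀ := lt_of_lt_of_le hδ hδt₀
  have hpos : ∀ s, 0 < s → s < t₀ → 0 < r s := by
    intro s hs hst
    by_contra h
    by_cases hsδ : s < δ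
    · exact h (hδpos s hs hsδ)
    · exact absurd (csInf_le hbdd ⟨not_lt.1 hsδ, not_lt.1 h⟩) (not_le.2 hst)
  -- a short interval to the left of `t₀`
  set q := fracKernel α t₀ / (a * fracKernel α (t₀ / 2)) with hq
  have hq0 : 0 < q :=
    div_pos (fracKernel_pos hα ht₀) (mul_pos ha (fracKernel_pos hα (half_pos ht₀)))
  have hK : Tendsto (fracKernel (α + 1)) (𝓝 0) (𝓝 0) := by
    have h := (Real.continuousAt_rpow_const 0 (α + 1 - 1) (Or.inr (by linarith))).div_const
      (Real.Gamma (α + 1))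
    have h' : (0 : ℝ) ^ (α + 1 - 1) / Real.Gamma (α + 1) = 0 := by
      rw [add_sub_cancel_right, Real.zero_rpow hα.ne', zero_div]
    rw [ContinuousAt, h'] at h
    exact h
  obtain ⟨η, hη, hηK⟩ := Metric.eventually_nhds_iff.1 (hK.eventually_lt_const hq0)
  -- Below `η` the integrated kernel is less than `q`; the bound `t₀ / 2` keeps the maximiser in
  -- `[t₀ / 2, t₀)`, where the kernel is at most its value at `t₀ / 2`. The definition of `q` makes
  -- these two facts contradict the comparison below.
  set d := min (η / 2) (t₀ / 2) with hd
  have hd0 : 0 < d := lt_min (half_pos hη) (half_pos ht₀)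
  have hdt : d ≤ t₀ / 2 := min_le_right _ _
  have hdη : d < η := (min_le_left _ _).trans_lt (by linarith)
  have hIcc : Set.Icc (t₀ - d) t₀ ⊆ Set.Ioi 0 := fun s hs => by
    have := hs.1; simp only [Set.mem_Ioi]; linarith
  obtain ⟨τ, hτ, hmax⟩ := isCompact_Icc.exists_isMaxOn
    (Set.nonempty_Icc.2 (by linarith : t₀ - d ≤ t₀)) (hcont.mono hIcc)
  have hτ0 : 0 < τ := hIcc hτ
  have hrτ : 0 < r τ :=
    lt_of_lt_of_le (hpos (t₀ - d) (by linarith) (by linarith))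
      (hmax (Set.left_mem_Icc.2 (by linarith)))
  have hττ : τ < t₀ := lt_of_le_of_ne hτ.2 fun h => by rw [h] at hrτ; linarith
  -- the resolvent equation at `τ` and at `t₀`
  have e₀ := resolventKernel_add_integral hα ha ht₀
  have eτ := resolventKernel_add_integral hα ha hτ0
  have i₀ := intervalIntegrable_fracKernel_mul_resolventKernel hα ha ht₀
  have iτ := intervalIntegrable_fracKernel_mul_resolventKernel hα ha hτ0
  rw [← hr] at e₀ eτ i₀ iτ
  have i₁ : IntervalIntegrable (fun u => fracKernel α (t₀ - u) * r u) volume 0 τ :=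
    i₀.mono_set (Set.uIcc_subset_uIcc_left (Set.mem_uIcc.2 (Or.inl ⟨hτ0.le, hτ.2⟩)))
  have i₂ : IntervalIntegrable (fun u => fracKernel α (t₀ - u) * r u) volume τ t₀ :=
    i₀.mono_set (Set.uIcc_subset_uIcc_right (Set.mem_uIcc.2 (Or.inl ⟨hτ0.le, hτ.2⟩)))
  have hsplit := intervalIntegral.integral_add_adjacent_intervals i₁ i₂
  have hkτ := fracKernel_pos hα hτ0
  have hkt₀ := fracKernel_pos hα ht₀
  have b₁ : fracKernel α τ * ∫ u in (0 : ℝ)..τ, fracKernel α (t₀ - u) * r u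
      ≤ fracKernel α t₀ * ∫ u in (0 : ℝ)..τ, fracKernel α (τ - u) * r u := by
    rw [← intervalIntegral.integral_const_mul, ← intervalIntegral.integral_const_mul]
    refine intervalIntegral.integral_mono_on_of_le_Ioo hτ0.le (i₁.const_mul _) (iτ.const_mul _)
      fun u hu => ?_
    have h1 := fracKernel_ratio_le hα hα1 hu.1.le hu.2 hτ.2
    have h2 := mul_le_mul_of_nonneg_right h1 (hpos u hu.1 (hu.2.trans hττ)).le
    linarith
  have i₃ : IntervalIntegrable (fun u => fracKernel α (t₀ - u)) volume τ t₀ := by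
    have h := (intervalIntegrable_fracKernel hα (sub_pos.2 hττ)).comp_sub_left t₀
    simpa using h.symm
  -- Here the choice of a maximiser matters: `r ≤ r τ` on all of `[τ, t₀]`.
  have b₂ : ∫ u in τ..t₀, fracKernel α (t₀ - u) * r u ≤ r τ * fracKernel (α + 1) (t₀ - τ) := by
    have h1 : ∫ u in τ..t₀, fracKernel α (t₀ - u) = fracKernel (α + 1) (t₀ - τ) := by
      rw [← integral_fracKernel hα (sub_pos.2 hττ),
        intervalIntegral.integral_comp_sub_left (fun u => fracKernel α u) t₀, sub_self]
    rw [← h1, ← intervalIntegral.integral_const_mul]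
    refine intervalIntegral.integral_mono_on_of_le_Ioo hττ.le i₂ (i₃.const_mul _)
      fun u hu => ?_
    rw [mul_comm (r τ)]
    exact mul_le_mul_of_nonneg_left (hmax ⟨hτ.1.trans hu.1.le, hu.2.le⟩)
      (fracKernel_nonneg hα (sub_nonneg.2 hu.2.le))
  have hKτ : fracKernel (α + 1) (t₀ - τ) < q :=
    hηK (by rw [Real.dist_eq, sub_zero, abs_of_pos (sub_pos.2 hττ)]; linarith [hτ.1])
  have hkhalf : fracKernel α τ ≤ fracKernel α (t₀ / 2) :=
    fracKernel_antitone hα hα1 (half_pos ht₀) (by linarith [hτ.1])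
  -- conclusion
  have c₁ : fracKernel α t₀ ≤ ∫ u in (0 : ℝ)..t₀, fracKernel α (t₀ - u) * r u := by
    have : a * fracKernel α t₀ ≤ a * ∫ u in (0 : ℝ)..t₀, fracKernel α (t₀ - u) * r u := by
      linarith
    exact le_of_mul_le_mul_left this ha
  -- Multiply `c₁` by `a * fracKernel α τ` and replace the integral up to `τ` through the equation
  -- at `τ`; the products `a * fracKernel α τ * fracKernel α t₀` cancel and leave `r τ` on the left.
  have c₂ : fracKernel α t₀ * r τ ≤ a * fracKernel α τ * (r τ * fracKernel (α + 1) (t₀ - τ)) := by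
    have h1 : fracKernel α τ * fracKernel α t₀ ≤
        fracKernel α t₀ * (∫ u in (0 : ℝ)..τ, fracKernel α (τ - u) * r u) +
          fracKernel α τ * (r τ * fracKernel (α + 1) (t₀ - τ)) := by
      calc fracKernel α τ * fracKernel α t₀
          ≤ fracKernel α τ * ∫ u in (0 : ℝ)..t₀, fracKernel α (t₀ - u) * r u :=
            mul_le_mul_of_nonneg_left c₁ hkτ.le
        _ = fracKernel α τ * (∫ u in (0 : ℝ)..τ, fracKernel α (t₀ - u) * r u) +
            fracKernel α τ * ∫ u in τ..t₀, fracKernel α (t₀ - u) * r u := by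
            rw [← hsplit, mul_add]
        _ ≤ _ := add_le_add b₁ (mul_le_mul_of_nonneg_left b₂ hkτ.le)
    have h2 := mul_le_mul_of_nonneg_left h1 ha.le
    have h3 : fracKernel α t₀ * (r τ + a * ∫ u in (0 : ℝ)..τ, fracKernel α (τ - u) * r u)
        = fracKernel α t₀ * (a * fracKernel α τ) := by rw [eτ]
    linarith
  have c₃ : fracKernel α t₀ ≤ a * fracKernel α τ * fracKernel (α + 1) (t₀ - τ) := by
    refine le_of_mul_le_mul_right ?_ hrτ
    linarith
  have c₄ : a * fracKernel α τ * fracKernel (α + 1) (t₀ - τ) < fracKernel α t₀ := by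
    have hK0 : 0 ≤ fracKernel (α + 1) (t₀ - τ) :=
      fracKernel_nonneg (by linarith) (sub_nonneg.2 hτ.2)
    have hk := fracKernel_pos hα (half_pos ht₀)
    calc a * fracKernel α τ * fracKernel (α + 1) (t₀ - τ)
        ≤ a * fracKernel α (t₀ / 2) * fracKernel (α + 1) (t₀ - τ) := by gcongr
      _ < a * fracKernel α (t₀ / 2) * q := by gcongr
      _ = fracKernel α t₀ := by rw [hq]; field_simp
  linarith

lemma resolventKernel_nonneg (hα : 0 < α) (hα1 : α ≤ 1) (ha : 0 < a) (t : ℝ) :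
    0 ≤ resolventKernel α a t := by
  by_cases ht : 0 < t
  · exact (resolventKernel_pos hα hα1 ha ht).le
  · rw [resolventKernel, Set.indicator_of_notMem (by simpa using ht)]

lemma resolventKernel_le (hα : 0 < α) (hα1 : α ≤ 1) (ha : 0 < a) {t : ℝ} (ht : 0 < t) :
    resolventKernel α a t ≤ a * fracKernel α t := by
  rw [← resolventKernel_add_integral hα ha ht]
  refine le_add_of_nonneg_right (mul_nonneg ha.le (intervalIntegral.integral_nonneg ht.le ?_))
  intro u hu
  exact mul_nonneg (fracKernel_nonneg hα (sub_nonneg.2 hu.2)) (resolventKernel_nonneg hα hα1 ha u)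

lemma integrableOn_exp_mul_resolventKernel (hα : 0 < α) (hα1 : α ≤ 1) (ha : 0 < a) {c : ℝ}
    (hc : 0 < c) :
    IntegrableOn (fun t => Real.exp (-(c * t)) * resolventKernel α a t) (Set.Ioi 0) := by
  refine Integrable.mono' ((integrableOn_exp_mul_fracKernel hα hc).const_mul a) ?_ ?_
  · have := measurable_resolventKernel (α := α) (a := a) hα ha
    exact (by fun_prop : Measurable fun t => Real.exp (-(c * t)) * resolventKernel α a t).aestronglyMeasurable
  · filter_upwards [ae_restrict_mem measurableSet_Ioi] with t ht
    rw [Real.norm_eq_abs, abs_mul, abs_of_pos (Real.exp_pos _),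
      abs_of_nonneg (resolventKernel_nonneg hα hα1 ha t)]
    have := mul_le_mul_of_nonneg_left (resolventKernel_le hα hα1 ha ht) (Real.exp_pos (-(c * t))).le
    linarith

/-- The Laplace transform of the resolvent. -/
lemma integral_exp_mul_resolventKernel (hα : 0 < α) (hα1 : α ≤ 1) (ha : 0 < a) {c : ℝ}
    (hc : 0 < c) :
    ∫ t in Set.Ioi (0 : ℝ), Real.exp (-(c * t)) * resolventKernel α a t = a / (c ^ α + a) := by
  have ir := integrableOn_exp_mul_resolventKernel hα hα1 ha hc
  have ik := integrableOn_exp_mul_fracKernel hα hc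
  -- Exponential weights commute with convolution, so the resolvent equation becomes `R c^(-α) =
  -- c^(-α) - R / a` for the transform `R`.
  have h := integral_posConvolution ir ik (ContinuousLinearMap.mul ℝ ℝ)
  simp only [ContinuousLinearMap.mul_apply'] at h
  have h1 : ∀ x ∈ Set.Ioi (0 : ℝ), (∫ t in (0 : ℝ)..x,
      Real.exp (-(c * t)) * resolventKernel α a t * (Real.exp (-(c * (x - t))) *
        fracKernel α (x - t))) =
      Real.exp (-(c * x)) * fracKernel α x - (1 / a) * (Real.exp (-(c * x)) * resolventKernel α a x) := by
    intro x hx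
    have h2 : ∀ t, Real.exp (-(c * t)) * resolventKernel α a t * (Real.exp (-(c * (x - t))) *
        fracKernel α (x - t)) = Real.exp (-(c * x)) * (fracKernel α (x - t) * resolventKernel α a t) := by
      intro t
      have : Real.exp (-(c * x)) = Real.exp (-(c * t)) * Real.exp (-(c * (x - t))) := by
        rw [← Real.exp_add]; congr 1; ring
      rw [this]; ring
    simp_rw [h2]
    rw [intervalIntegral.integral_const_mul]
    have e := resolventKernel_add_integral hα ha hx
    have e' : ∫ u in (0 : ℝ)..x, fracKernel α (x - u) * resolventKernel α a u
        = fracKernel α x - (1 / a) * resolventKernel α a x := by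
      field_simp
      linarith
    rw [e']; ring
  rw [setIntegral_congr_fun measurableSet_Ioi h1, integral_sub ik (ir.const_mul _),
    integral_const_mul, integral_exp_mul_fracKernel hα hc] at h
  have hcα := Real.rpow_pos_of_pos hc α
  set R := ∫ t in Set.Ioi (0 : ℝ), Real.exp (-(c * t)) * resolventKernel α a t
  have h3 : c ^ α + a ≠ 0 := by positivity
  field_simp at h ⊢
  linarith

end ResolventSign

/-! ### Total mass of the resolvent -/

section ResolventMass

variable {α a : ℝ}

lemma intervalIntegrable_resolventKernel (hα : 0 < α) (hα1 : α ≤ 1) (ha : 0 < a) {t : ℝ}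
    (ht : 0 ≤ t) : IntervalIntegrable (resolventKernel α a) volume 0 t := by
  rcases ht.eq_or_lt with rfl | ht
  · exact IntervalIntegrable.refl
  · have h := (intervalIntegrable_fracKernel hα ht).const_mul a
    rw [intervalIntegrable_iff_integrableOn_Ioc_of_le ht.le] at h ⊢
    refine Integrable.mono' h (measurable_resolventKernel hα ha).aestronglyMeasurable ?_
    filter_upwards [ae_restrict_mem measurableSet_Ioc] with u hu
    rw [Real.norm_eq_abs, abs_of_nonneg (resolventKernel_nonneg hα hα1 ha u)]
    exact resolventKernel_le hα hα1 ha hu.1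

lemma intervalIntegrable_exp_mul_resolventKernel (hα : 0 < α) (hα1 : α ≤ 1) (ha : 0 < a) (c : ℝ)
    {t : ℝ} (ht : 0 ≤ t) :
    IntervalIntegrable (fun u => Real.exp (-(c * u)) * resolventKernel α a u) volume 0 t :=
  (intervalIntegrable_resolventKernel hα hα1 ha ht).continuousOn_mul (by fun_prop)

lemma tendsto_integral_exp_mul_resolventKernel (hα : 0 < α) (hα1 : α ≤ 1) (ha : 0 < a) {c : ℝ}
    (hc : 0 < c) :
    Tendsto (fun t => ∫ u in (0 : ℝ)..t, Real.exp (-(c * u)) * resolventKernel α a u) atTop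
      (𝓝 (a / (c ^ α + a))) := by
  rw [← integral_exp_mul_resolventKernel hα hα1 ha hc]
  exact intervalIntegral_tendsto_integral_Ioi 0
    (integrableOn_exp_mul_resolventKernel hα hα1 ha hc) tendsto_id

lemma integral_le_of_tendsto {k : ℝ → ℝ} {K : ℝ} (hk0 : ∀ s, 0 ≤ k s)
    (hk : ∀ t, 0 ≤ t → IntervalIntegrable k volume 0 t)
    (hK : Tendsto (fun t => ∫ u in (0 : ℝ)..t, k u) atTop (𝓝 K)) {t : ℝ} (ht : 0 ≤ t) :
    ∫ u in (0 : ℝ)..t, k u ≤ K := by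
  refine ge_of_tendsto hK ?_
  filter_upwards [eventually_ge_atTop t] with s hs
  exact intervalIntegral.integral_mono_interval le_rfl ht hs (Eventually.of_forall hk0)
    (hk s (ht.trans hs))

/-- On `[0, t]` removing the weight costs at most `exp (c t)`, and the weighted mass `a / (c ^ α +
a)` is at most `1`; let `c → 0`. -/
lemma integral_resolventKernel_le_one (hα : 0 < α) (hα1 : α ≤ 1) (ha : 0 < a) {t : ℝ}
    (ht : 0 ≤ t) : ∫ u in (0 : ℝ)..t, resolventKernel α a u ≤ 1 := by
  have h1 : ∀ c : ℝ, 0 < c → ∫ u in (0 : ℝ)..t, resolventKernel α a u ≤ Real.exp (c * t) := by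
    intro c hc
    have h2 := integral_le_of_tendsto
      (fun s => mul_nonneg (Real.exp_pos (-(c * s))).le (resolventKernel_nonneg hα hα1 ha s))
      (fun t ht => intervalIntegrable_exp_mul_resolventKernel hα hα1 ha c ht)
      (tendsto_integral_exp_mul_resolventKernel hα hα1 ha hc) ht
    have h3 : a / (c ^ α + a) ≤ 1 := by
      have := Real.rpow_pos_of_pos hc α
      rw [div_le_one (by positivity)]; linarith
    have h4 : Real.exp (-(c * t)) * ∫ u in (0 : ℝ)..t, resolventKernel α a u
        ≤ ∫ u in (0 : ℝ)..t, Real.exp (-(c * u)) * resolventKernel α a u := by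
      rw [← intervalIntegral.integral_const_mul]
      refine intervalIntegral.integral_mono_on ht
        ((intervalIntegrable_resolventKernel hα hα1 ha ht).const_mul _)
        (intervalIntegrable_exp_mul_resolventKernel hα hα1 ha c ht) fun u hu => ?_
      refine mul_le_mul_of_nonneg_right (Real.exp_le_exp.2 ?_) (resolventKernel_nonneg hα hα1 ha u)
      have := mul_le_mul_of_nonneg_left hu.2 hc.le
      linarith
    have h5 := h4.trans (h2.trans h3)
    rw [Real.exp_neg, inv_mul_le_iff₀ (Real.exp_pos _), mul_one] at h5
    exact h5
  have h6 : Tendsto (fun c : ℝ => Real.exp (c * t)) (𝓝[>] 0) (𝓝 1) := by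
    have : Continuous fun c : ℝ => Real.exp (c * t) := by fun_prop
    have h7 := this.tendsto 0
    rw [zero_mul, Real.exp_zero] at h7
    exact h7.mono_left nhdsWithin_le_nhds
  refine ge_of_tendsto h6 ?_
  filter_upwards [self_mem_nhdsWithin] with c hc
  exact h1 c hc

/-- The resolvent has total mass one. -/
lemma tendsto_integral_resolventKernel (hα : 0 < α) (hα1 : α ≤ 1) (ha : 0 < a) :
    Tendsto (fun t => ∫ u in (0 : ℝ)..t, resolventKernel α a u) atTop (𝓝 1) := by
  refine tendsto_order.2 ⟨fun b hb => ?_, fun b hb => ?_⟩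
  -- Abelian argument: for small `c` the weighted mass already exceeds `b`, and the weight is at
  -- most `1`.
  · have h1 : Tendsto (fun c : ℝ => a / (c ^ α + a)) (𝓝[>] 0) (𝓝 1) := by
      have h2 := (Real.continuousAt_rpow_const 0 α (Or.inr hα.le)).tendsto.add_const a
      rw [Real.zero_rpow hα.ne', zero_add] at h2
      have h3 := (tendsto_const_nhds (x := a)).div h2 ha.ne'
      rw [div_self ha.ne'] at h3
      exact h3.mono_left nhdsWithin_le_nhds
    obtain ⟨c, hcb, hc⟩ := ((h1.eventually_const_lt hb).and self_mem_nhdsWithin).exists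
    filter_upwards [(tendsto_integral_exp_mul_resolventKernel hα hα1 ha hc).eventually_const_lt hcb,
      eventually_ge_atTop 0] with t htb ht
    refine htb.trans_le (intervalIntegral.integral_mono_on ht
        (intervalIntegrable_exp_mul_resolventKernel hα hα1 ha c ht)
        (intervalIntegrable_resolventKernel hα hα1 ha ht) fun u hu => ?_)
    refine mul_le_of_le_one_left (resolventKernel_nonneg hα hα1 ha u) (Real.exp_le_one_iff.2 ?_)
    have := mul_nonneg (le_of_lt hc) hu.1
    linarith
  · filter_upwards [eventually_ge_atTop 0] with t ht
    exact (integral_resolventKernel_le_one hα hα1 ha ht).trans_lt hb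

end ResolventMass

/-! ### Convolution with a nonnegative kernel of finite mass -/

section KernelConvolution

lemma integrableOn_comp_sub_mul {k g : ℝ → ℝ} {t B : ℝ} (ht : 0 ≤ t)
    (hk : IntervalIntegrable k volume 0 t)
    (hg : AEStronglyMeasurable g (volume.restrict (Set.Ioc 0 t)))
    (hB : ∀ s ∈ Set.Ioc 0 t, |g s| ≤ B) :
    IntegrableOn (fun s => k (t - s) * g s) (Set.Ioc 0 t) := by
  have h : IntervalIntegrable (fun s => k (t - s)) volume 0 t := by
    simpa using (hk.comp_sub_left t).symm
  rw [intervalIntegrable_iff_integrableOn_Ioc_of_le ht] at h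
  refine Integrable.mul_bdd (c := B) h hg ?_
  filter_upwards [ae_restrict_mem measurableSet_Ioc] with s hs
  exact hB s hs

lemma abs_integral_comp_sub_mul_le {k g : ℝ → ℝ} {t t₁ t₂ B : ℝ} (ht12 : t₁ ≤ t₂)
    (ht2 : t₂ ≤ t) (hk0 : ∀ s, 0 ≤ s → 0 ≤ k s) (hk : ∀ t, 0 ≤ t → IntervalIntegrable k volume 0 t)
    (hB : ∀ s ∈ Set.Ioc t₁ t₂, |g s| ≤ B) :
    |∫ s in t₁..t₂, k (t - s) * g s| ≤ (∫ u in (t - t₂)..(t - t₁), k u) * B := by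
  have h1 : ∫ u in (t - t₂)..(t - t₁), k u = ∫ s in t₁..t₂, k (t - s) :=
    (intervalIntegral.integral_comp_sub_left k t).symm
  have h2 : IntervalIntegrable (fun s => k (t - s)) volume t₁ t₂ := by
    have h3 : IntervalIntegrable k volume (t - t₂) (t - t₁) :=
      (hk _ (by linarith)).symm.trans (hk _ (by linarith))
    simpa using (h3.comp_sub_left t).symm
  rw [h1, ← intervalIntegral.integral_mul_const, ← Real.norm_eq_abs]
  refine intervalIntegral.norm_integral_le_of_norm_le ht12 ?_ (h2.mul_const B)
  refine Eventually.of_forall fun s hs => ?_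
  have hks := hk0 (t - s) (by linarith [hs.2])
  rw [Real.norm_eq_abs, abs_mul, abs_of_nonneg hks]
  exact mul_le_mul_of_nonneg_left (hB s hs) hks

/-- Convolution with a nonnegative kernel of mass `K` multiplies an eventual bound by `K`,
up to an arbitrarily small error. -/
lemma eventually_abs_integral_comp_sub_mul_le {k g : ℝ → ℝ} {K B β η : ℝ}
    (hk0 : ∀ s, 0 ≤ k s) (hk : ∀ t, 0 ≤ t → IntervalIntegrable k volume 0 t)
    (hK : Tendsto (fun t => ∫ u in (0 : ℝ)..t, k u) atTop (𝓝 K))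
    (hg : ∀ t, 0 ≤ t → AEStronglyMeasurable g (volume.restrict (Set.Ioc 0 t)))
    (hB : ∀ s, 0 ≤ s → |g s| ≤ B) (hβ0 : 0 ≤ β) (hβ : ∀ᶠ s in atTop, |g s| ≤ β) (hη : 0 < η) :
    ∀ᶠ t in atTop, |∫ s in (0 : ℝ)..t, k (t - s) * g s| ≤ K * β + η := by
  obtain ⟨T, hT⟩ := eventually_atTop.1 (hβ.and (eventually_ge_atTop 0))
  have hT0 : 0 ≤ T := (hT T le_rfl).2
  have hB0 : 0 ≤ B := (abs_nonneg _).trans (hB 0 le_rfl)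
  -- Before `T` only the global bound `B` holds, but those times meet the kernel on `(t - T, t)`,
  -- whose mass vanishes because the primitive converges.
  have htail : Tendsto (fun t => (∫ u in (t - T)..t, k u) * B) atTop (𝓝 0) := by
    have h1 : Tendsto (fun t : ℝ => t - T) atTop atTop := tendsto_atTop_add_const_right _ _ tendsto_id
    have h2 := ((hK.sub (hK.comp h1)).mul_const B)
    rw [sub_self, zero_mul] at h2
    refine h2.congr' ?_
    filter_upwards [eventually_ge_atTop T] with t ht
    simp only [Function.comp_apply]
    rw [intervalIntegral.integral_interval_sub_left (hk t (by linarith)) (hk _ (by linarith))]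
  filter_upwards [htail.eventually_lt_const hη, eventually_ge_atTop T] with t htη htT
  have ht0 := hT0.trans htT
  have hint : IntervalIntegrable (fun s => k (t - s) * g s) volume 0 t := by
    rw [intervalIntegrable_iff_integrableOn_Ioc_of_le ht0]
    exact integrableOn_comp_sub_mul ht0 (hk t ht0) (hg t ht0) fun s hs => hB s hs.1.le
  have i₁ : IntervalIntegrable (fun s => k (t - s) * g s) volume 0 T :=
    hint.mono_set (Set.uIcc_subset_uIcc_left (Set.mem_uIcc.2 (Or.inl ⟨hT0, htT⟩)))
  have i₂ : IntervalIntegrable (fun s => k (t - s) * g s) volume T t :=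
    hint.mono_set (Set.uIcc_subset_uIcc_right (Set.mem_uIcc.2 (Or.inl ⟨hT0, htT⟩)))
  rw [← intervalIntegral.integral_add_adjacent_intervals i₁ i₂]
  have b₁ := abs_integral_comp_sub_mul_le (g := g) (B := B) hT0 htT (fun s _ => hk0 s) hk
    fun s hs => hB s hs.1.le
  have b₂ := abs_integral_comp_sub_mul_le (g := g) (B := β) htT le_rfl (fun s _ => hk0 s) hk
    fun s hs => (hT s hs.1.le).1
  rw [sub_zero] at b₁
  rw [sub_self] at b₂
  have b₃ : (∫ u in (0 : ℝ)..(t - T), k u) * β ≤ K * β :=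
    mul_le_mul_of_nonneg_right (integral_le_of_tendsto hk0 hk hK (by linarith)) hβ0
  refine (abs_add_le _ _).trans ?_
  linarith

end KernelConvolution

/-! ### Variation of constants -/

section VariationOfConstants

variable {α a : ℝ} {u g : ℝ → ℝ} {T B u₀ : ℝ}

lemma integral_resolventKernel_mul_fracKernel (hα : 0 < α) (ha : 0 < a) {s : ℝ} (hs : 0 < s) :
    IntervalIntegrable (fun u => resolventKernel α a (s - u) * fracKernel α u) volume 0 s ∧
    ∫ u in (0 : ℝ)..s, resolventKernel α a (s - u) * fracKernel α u
      = fracKernel α s - (1 / a) * resolventKernel α a s := by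
  have h1 := (intervalIntegrable_fracKernel_mul_resolventKernel hα ha hs).comp_sub_left s
  have h2 := intervalIntegral.integral_comp_sub_left (a := 0) (b := s)
    (fun u => fracKernel α (s - u) * resolventKernel α a u) s
  have h3 := resolventKernel_add_integral hα ha hs
  simp only [sub_sub_cancel, sub_self, sub_zero] at h1 h2
  refine ⟨h1.symm.congr (fun u _ => mul_comm _ _), ?_⟩
  have h4 : ∫ u in (0 : ℝ)..s, resolventKernel α a (s - u) * fracKernel α u
      = ∫ u in (0 : ℝ)..s, fracKernel α (s - u) * resolventKernel α a u := by
    rw [← h2]; simp only [mul_comm]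
  rw [h4]
  field_simp
  linarith

/-- Variation of constants for the equation `u = u₀ - κ ∗ (a u + g)`. -/
lemma variation_of_constants (hα : 0 < α) (hα1 : α ≤ 1) (ha : 0 < a) (hT : 0 < T)
    (hu : AEStronglyMeasurable u (volume.restrict (Set.Ioc 0 T)))
    (hg : AEStronglyMeasurable g (volume.restrict (Set.Ioc 0 T)))
    (huB : ∀ s ∈ Set.Icc 0 T, |u s| ≤ B) (hgB : ∀ s ∈ Set.Icc 0 T, |g s| ≤ B)
    (heq : ∀ t ∈ Set.Icc 0 T,
      u t = u₀ - ∫ s in (0 : ℝ)..t, fracKernel α (t - s) * (a * u s + g s)) :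
    u T = u₀ * (1 - ∫ s in (0 : ℝ)..T, resolventKernel α a s)
      - (1 / a) * ∫ s in (0 : ℝ)..T, resolventKernel α a (T - s) * g s := by
  set r := resolventKernel α a with hr
  have hri := intervalIntegrable_resolventKernel hα hα1 ha hT.le
  have hki := intervalIntegrable_fracKernel hα hT
  set h : ℝ → ℝ := fun s => a * u s + g s with hh
  have hhm : AEStronglyMeasurable h (volume.restrict (Set.Ioc 0 T)) := (hu.const_mul a).add hg
  have hhB : ∀ s ∈ Set.Ioc 0 T, |h s| ≤ a * B + B := by
    intro s hs
    have hs' := Set.Ioc_subset_Icc_self hs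
    refine (abs_add_le _ _).trans (add_le_add ?_ (hgB s hs'))
    rw [abs_mul, abs_of_pos ha]
    exact mul_le_mul_of_nonneg_left (huB s hs') ha.le
  have ikh := integrableOn_comp_sub_mul hT.le hki hhm hhB
  have irh := integrableOn_comp_sub_mul hT.le hri hhm hhB
  have iru := integrableOn_comp_sub_mul hT.le hri hu fun s hs => huB s (Set.Ioc_subset_Icc_self hs)
  have irg := integrableOn_comp_sub_mul hT.le hri hg fun s hs => hgB s (Set.Ioc_subset_Icc_self hs)
  have ir1 : IntervalIntegrable (fun s => r (T - s)) volume 0 T := by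
    simpa using (hri.comp_sub_left T).symm
  have hc : IntegrableOn (fun v => (fracKernel α (T - v) - (1 / a) * r (T - v)) * h v)
      (Set.Ioc 0 T) := by
    refine (ikh.sub (irh.const_mul (1 / a))).congr (Eventually.of_forall fun s => ?_)
    simp only [Pi.sub_apply]; ring
  -- Convolving the equation with `r` uses `r ∗ κ = κ - r / a`, the resolvent equation with its
  -- factors exchanged.
  have hassoc := integral_volterra_assoc (f := r) (g := fracKernel α) (h := h)
    (c := fun s => fracKernel α s - (1 / a) * r s)
    (measurable_resolventKernel hα ha) (measurable_fracKernel α)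
    (fun s _ => resolventKernel_nonneg hα hα1 ha s) (fun s hs => fracKernel_nonneg hα hs.le) hhm
    (fun s hs _ => (integral_resolventKernel_mul_fracKernel hα ha hs).1)
    (fun s hs _ => (integral_resolventKernel_mul_fracKernel hα ha hs).2) hc hT.le
  rw [← intervalIntegrable_iff_integrableOn_Ioc_of_le hT.le] at ikh irh iru irg
  have h1 : ∫ s in (0 : ℝ)..T, r (T - s) * u s = u₀ * (∫ s in (0 : ℝ)..T, r s)
      - ∫ s in (0 : ℝ)..T, r (T - s) * ∫ v in (0 : ℝ)..s, fracKernel α (s - v) * h v := by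
    have h2 : ∀ s ∈ Set.uIcc 0 T, r (T - s) * ∫ v in (0 : ℝ)..s, fracKernel α (s - v) * h v
        = u₀ * r (T - s) - r (T - s) * u s := by
      intro s hs
      rw [Set.uIcc_of_le hT.le] at hs
      rw [heq s hs]; ring
    rw [intervalIntegral.integral_congr h2, intervalIntegral.integral_sub (ir1.const_mul _) iru,
      intervalIntegral.integral_const_mul, intervalIntegral.integral_comp_sub_left r T, sub_self,
      sub_zero]
    ring
  have h3 : ∫ v in (0 : ℝ)..T, (fracKernel α (T - v) - (1 / a) * r (T - v)) * h v
      = (∫ v in (0 : ℝ)..T, fracKernel α (T - v) * h v)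
        - (1 / a) * ∫ v in (0 : ℝ)..T, r (T - v) * h v := by
    rw [← intervalIntegral.integral_const_mul, ← intervalIntegral.integral_sub ikh (irh.const_mul _)]
    refine intervalIntegral.integral_congr fun v _ => ?_
    ring
  have h4 : ∫ v in (0 : ℝ)..T, r (T - v) * h v
      = a * (∫ v in (0 : ℝ)..T, r (T - v) * u v) + ∫ v in (0 : ℝ)..T, r (T - v) * g v := by
    rw [← intervalIntegral.integral_const_mul, ← intervalIntegral.integral_add (iru.const_mul _) irg]
    refine intervalIntegral.integral_congr fun v _ => ?_
    simp only [hh]; ring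
  have h5 := heq T (Set.right_mem_Icc.2 hT.le)
  rw [h3, h4] at hassoc
  rw [hassoc] at h1
  have h6 : (1 / a) * (a * ∫ v in (0 : ℝ)..T, r (T - v) * u v)
      = ∫ v in (0 : ℝ)..T, r (T - v) * u v := by field_simp
  rw [mul_add, h6] at h1
  -- In `h1` the terms `r ∗ u` cancel, leaving `κ ∗ h = u₀ ∫ r + (1 / a) r ∗ g`, which is inserted
  -- in the equation at `T`.
  linear_combination h5 - h1

/-- Variation of constants for the exponentially tempered equation. -/
lemma variation_of_constants_exp (hα : 0 < α) (hα1 : α ≤ 1) (ha : 0 < a) {lam : ℝ} (hlam : 0 ≤ lam)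
    (hT : 0 < T)
    (hu : AEStronglyMeasurable u (volume.restrict (Set.Ioc 0 T)))
    (hg : AEStronglyMeasurable g (volume.restrict (Set.Ioc 0 T)))
    (huB : ∀ s ∈ Set.Icc 0 T, |u s| ≤ B) (hgB : ∀ s ∈ Set.Icc 0 T, |g s| ≤ B)
    (heq : ∀ t ∈ Set.Icc 0 T, u t = Real.exp (-(lam * t)) * u₀ -
      ∫ s in (0 : ℝ)..t, Real.exp (-(lam * (t - s))) * fracKernel α (t - s) * (a * u s + g s)) :
    u T = Real.exp (-(lam * T)) * u₀ * (1 - ∫ s in (0 : ℝ)..T, resolventKernel α a s)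
      - (1 / a) * ∫ s in (0 : ℝ)..T,
          Real.exp (-(lam * (T - s))) * resolventKernel α a (T - s) * g s := by
  have hexp : ∀ t s : ℝ,
      Real.exp (-(lam * (t - s))) = Real.exp (-(lam * t)) * Real.exp (lam * s) := fun t s => by
    rw [← Real.exp_add]; congr 1; ring
  have hinv : ∀ t : ℝ, Real.exp (lam * t) * Real.exp (-(lam * t)) = 1 := fun t => by
    rw [← Real.exp_add]; simp
  have hE : Measurable fun s : ℝ => Real.exp (lam * s) := by fun_prop
  have hbd : ∀ f : ℝ → ℝ, (∀ s ∈ Set.Icc 0 T, |f s| ≤ B) →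
      ∀ s ∈ Set.Icc 0 T, |Real.exp (lam * s) * f s| ≤ Real.exp (lam * T) * B := by
    intro f hf s hs
    rw [abs_mul, abs_of_pos (Real.exp_pos _)]
    exact mul_le_mul (Real.exp_le_exp.2 (mul_le_mul_of_nonneg_left hs.2 hlam)) (hf s hs)
      (abs_nonneg _) (Real.exp_pos _).le
  -- Multiplication by `exp (lam * s)` removes the tempering. The initial term is tempered too,
  -- which is why the untempered mass of the resolvent multiplies it in the result.
  have h := variation_of_constants (u := fun s => Real.exp (lam * s) * u s)
    (g := fun s => Real.exp (lam * s) * g s) (B := Real.exp (lam * T) * B) (u₀ := u₀) hα hα1 ha hT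
    (hE.aestronglyMeasurable.mul hu) (hE.aestronglyMeasurable.mul hg) (hbd u huB) (hbd g hgB) ?_
  · have h1 : ∫ s in (0 : ℝ)..T, Real.exp (-(lam * (T - s))) * resolventKernel α a (T - s) * g s
        = Real.exp (-(lam * T)) *
          ∫ s in (0 : ℝ)..T, resolventKernel α a (T - s) * (Real.exp (lam * s) * g s) := by
      rw [← intervalIntegral.integral_const_mul]
      refine intervalIntegral.integral_congr fun s _ => ?_
      rw [hexp]; ring
    rw [h1]
    linear_combination Real.exp (-(lam * T)) * h - u T * hinv T
  · intro t ht
    have h1 : ∫ s in (0 : ℝ)..t,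
        Real.exp (-(lam * (t - s))) * fracKernel α (t - s) * (a * u s + g s)
        = Real.exp (-(lam * t)) * ∫ s in (0 : ℝ)..t, fracKernel α (t - s) *
            (a * (Real.exp (lam * s) * u s) + Real.exp (lam * s) * g s) := by
      rw [← intervalIntegral.integral_const_mul]
      refine intervalIntegral.integral_congr fun s _ => ?_
      rw [hexp]; ring
    have h2 := heq t ht
    rw [h1] at h2
    linear_combination Real.exp (lam * t) * h2 + (u₀ - ∫ s in (0 : ℝ)..t, fracKernel α (t - s) *
            (a * (Real.exp (lam * s) * u s) + Real.exp (lam * s) * g s)) * hinv t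

end VariationOfConstants

/-! ### Decay of the moment system -/

section MomentSystem

variable {α a lam v : ℝ} {m q : ℝ → ℝ}

/-- Apply the contraction to the supremum over `[0, s + 1]`. It is finite a priori, so it can be
absorbed, and the resulting bound does not depend on the interval. -/
lemma exists_bound_of_contraction {f : ℝ → ℝ} {C θ : ℝ} (hθ1 : θ < 1)
    (hf : ∀ T : ℝ, 0 < T → ∃ B, ∀ s ∈ Set.Icc 0 T, |f s| ≤ B)
    (hcontr : ∀ T B : ℝ, 0 < T → (∀ s ∈ Set.Icc 0 T, |f s| ≤ B) →
      ∀ s ∈ Set.Icc 0 T, |f s| ≤ C + θ * B) :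
    ∀ s, 0 ≤ s → |f s| ≤ C / (1 - θ) := by
  intro s hs
  have hT : 0 < s + 1 := by linarith
  set S := (fun u => |f u|) '' Set.Icc 0 (s + 1) with hS
  obtain ⟨B, hB⟩ := hf (s + 1) hT
  have hbdd : BddAbove S := ⟨B, by rintro _ ⟨u, hu, rfl⟩; exact hB u hu⟩
  have hle : ∀ u ∈ Set.Icc 0 (s + 1), |f u| ≤ sSup S := fun u hu => le_csSup hbdd ⟨u, hu, rfl⟩
  have h1 : sSup S ≤ C + θ * sSup S := by
    refine csSup_le ⟨_, s, ⟨hs, by linarith⟩, rfl⟩ ?_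
    rintro _ ⟨u, hu, rfl⟩
    exact hcontr (s + 1) (sSup S) hT hle u hu
  refine (hle s ⟨hs, by linarith⟩).trans ?_
  rw [le_div_iff₀ (by linarith)]
  linarith

lemma tendsto_zero_of_eventually_contraction {f : ℝ → ℝ} {θ B : ℝ} (hθ0 : 0 < θ) (hθ1 : θ < 1)
    (hB0 : 0 < B) (hB : ∀ᶠ t in atTop, |f t| ≤ B)
    (hcontr : ∀ β, 0 < β → (∀ᶠ t in atTop, |f t| ≤ β) → ∀ᶠ t in atTop, |f t| ≤ θ * β) :
    Tendsto f atTop (𝓝 0) := by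
  have h1 : ∀ n : ℕ, ∀ᶠ t in atTop, |f t| ≤ θ ^ n * B := by
    intro n
    induction n with
    | zero => simpa using hB
    | succ n ih =>
      have := hcontr _ (by positivity) ih
      rwa [← mul_assoc, ← pow_succ'] at this
  have h2 : Tendsto (fun n : ℕ => θ ^ n * B) atTop (𝓝 0) := by
    simpa using (tendsto_pow_atTop_nhds_zero_of_lt_one hθ0.le hθ1).mul_const B
  rw [Metric.tendsto_nhds]
  intro ε hε
  obtain ⟨n, hn⟩ := (h2.eventually_lt_const hε).exists
  filter_upwards [h1 n] with t ht
  rw [Real.dist_eq, sub_zero]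
  exact ht.trans_lt hn

/-- Decay of the first moment for the linear Volterra system satisfied by the moments
`m = ⟨y⟩` and `q = ⟨ξ y⟩` of a fractional relaxation with dichotomous noise of variance `v`. -/
theorem tendsto_zero_of_moment_system (hα : 0 < α) (hα1 : α ≤ 1) (ha : 0 < a) (hlam : 0 < lam)
    (hv : 0 ≤ v) (hstab : v < a ^ 2 + lam ^ α * a)
    (hmm : ∀ t, 0 ≤ t → AEStronglyMeasurable m (volume.restrict (Set.Ioc 0 t)))
    (hqm : ∀ t, 0 ≤ t → AEStronglyMeasurable q (volume.restrict (Set.Ioc 0 t)))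
    (hmB : ∀ T : ℝ, 0 < T → ∃ B, ∀ s ∈ Set.Icc 0 T, |m s| ≤ B)
    (hqB : ∀ T : ℝ, 0 < T → ∃ B, ∀ s ∈ Set.Icc 0 T, |q s| ≤ B)
    (hm : ∀ t, 0 ≤ t → m t = m 0 - ∫ s in (0 : ℝ)..t, fracKernel α (t - s) * (a * m s + q s))
    (hq : ∀ t, 0 ≤ t → q t = Real.exp (-(lam * t)) * q 0 -
      ∫ s in (0 : ℝ)..t, Real.exp (-(lam * (t - s))) * fracKernel α (t - s) * (a * q s + v * m s)) :
    Tendsto m atTop (𝓝 0) := by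
  set r := resolventKernel α a with hr
  set ρ : ℝ → ℝ := fun u => Real.exp (-(lam * u)) * r u with hρ
  set R : ℝ → ℝ := fun t => ∫ s in (0 : ℝ)..t, r s with hR
  have hlα := Real.rpow_pos_of_pos hlam α
  have hr0 : ∀ s, 0 ≤ r s := resolventKernel_nonneg hα hα1 ha
  have hρ0 : ∀ s, 0 ≤ ρ s := fun s => mul_nonneg (Real.exp_pos _).le (hr0 s)
  have hri : ∀ t, 0 ≤ t → IntervalIntegrable r volume 0 t := fun t ht =>
    intervalIntegrable_resolventKernel hα hα1 ha ht
  have hρi : ∀ t, 0 ≤ t → IntervalIntegrable ρ volume 0 t := fun t ht =>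
    intervalIntegrable_exp_mul_resolventKernel hα hα1 ha lam ht
  have hrK : Tendsto R atTop (𝓝 1) := tendsto_integral_resolventKernel hα hα1 ha
  have hρK : Tendsto (fun t => ∫ s in (0 : ℝ)..t, ρ s) atTop (𝓝 (a / (lam ^ α + a))) :=
    tendsto_integral_exp_mul_resolventKernel hα hα1 ha hlam
  have hR1 : ∀ t, 0 ≤ t → R t ≤ 1 := fun t ht => integral_resolventKernel_le_one hα hα1 ha ht
  have hR0 : ∀ t, 0 ≤ t → 0 ≤ R t := fun t ht =>
    intervalIntegral.integral_nonneg ht fun u _ => hr0 u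
  -- representation by variation of constants
  have hbound : ∀ T : ℝ, 0 < T → ∃ B, (∀ s ∈ Set.Icc 0 T, |m s| ≤ B) ∧
      (∀ s ∈ Set.Icc 0 T, |q s| ≤ B) ∧ ∀ s ∈ Set.Icc 0 T, |v * m s| ≤ B := by
    intro T hT
    obtain ⟨B₁, hB₁⟩ := hmB T hT
    obtain ⟨B₂, hB₂⟩ := hqB T hT
    refine ⟨max (max B₁ B₂) (v * B₁), fun s hs => ?_, fun s hs => ?_, fun s hs => ?_⟩
    · exact (hB₁ s hs).trans ((le_max_left _ _).trans (le_max_left _ _))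
    · exact (hB₂ s hs).trans ((le_max_right _ _).trans (le_max_left _ _))
    · rw [abs_mul, abs_of_nonneg hv]
      exact (mul_le_mul_of_nonneg_left (hB₁ s hs) hv).trans (le_max_right _ _)
  have hmrep : ∀ t, 0 ≤ t → m t = m 0 * (1 - R t)
      - (1 / a) * ∫ s in (0 : ℝ)..t, r (t - s) * q s := by
    intro t ht
    rcases ht.eq_or_lt with rfl | ht
    · simp [hR]
    obtain ⟨B, hB₁, hB₂, -⟩ := hbound t ht
    exact variation_of_constants hα hα1 ha ht (hmm t ht.le) (hqm t ht.le) hB₁ hB₂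
      fun s hs => hm s hs.1
  have hqrep : ∀ t, 0 ≤ t → q t = Real.exp (-(lam * t)) * q 0 * (1 - R t)
      - (v / a) * ∫ s in (0 : ℝ)..t, ρ (t - s) * m s := by
    intro t ht
    rcases ht.eq_or_lt with rfl | ht
    · simp [hR]
    obtain ⟨B, -, hB₂, hB₃⟩ := hbound t ht
    have h := variation_of_constants_exp hα hα1 ha hlam.le ht (hqm t ht.le)
      ((hmm t ht.le).const_mul v) hB₂ hB₃ fun s hs => hq s hs.1
    have h1 : ∫ s in (0 : ℝ)..t, Real.exp (-(lam * (t - s))) * r (t - s) * (v * m s)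
        = v * ∫ s in (0 : ℝ)..t, ρ (t - s) * m s := by
      rw [← intervalIntegral.integral_const_mul]
      refine intervalIntegral.integral_congr fun s _ => ?_
      simp only [hρ]; ring
    rw [h, h1]; ring
  -- the contraction constant
  set D := v / (lam ^ α + a) with hD
  have hD0 : 0 ≤ D := by positivity
  -- This is the stability condition: `v < a (lam ^ α + a)`.
  have hDa : D < a := by
    rw [hD, div_lt_iff₀ (by positivity)]; linarith
  have hDv : (v / a) * (a / (lam ^ α + a)) = D := by rw [hD]; field_simp
  have hθ1 : D / a < 1 := (div_lt_one ha).2 hDa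
  have hqle : ∀ t, 0 ≤ t → |q t| ≤ |q 0| * (1 - R t) + (v / a) * |∫ s in (0 : ℝ)..t, ρ (t - s) * m s| := by
    intro t ht
    rw [hqrep t ht]
    refine (abs_sub _ _).trans (add_le_add ?_ ?_)
    · rw [abs_mul, abs_mul, abs_of_pos (Real.exp_pos _), abs_of_nonneg (sub_nonneg.2 (hR1 t ht))]
      refine mul_le_mul_of_nonneg_right ?_ (sub_nonneg.2 (hR1 t ht))
      refine mul_le_of_le_one_left (abs_nonneg _) (Real.exp_le_one_iff.2 ?_)
      have := mul_nonneg hlam.le ht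
      linarith
    · rw [abs_mul, abs_of_nonneg (div_nonneg hv ha.le)]
  have hmle : ∀ t, 0 ≤ t → |m t| ≤ |m 0| * (1 - R t) + (1 / a) * |∫ s in (0 : ℝ)..t, r (t - s) * q s| := by
    intro t ht
    rw [hmrep t ht]
    refine (abs_sub _ _).trans (add_le_add ?_ ?_)
    · rw [abs_mul, abs_of_nonneg (sub_nonneg.2 (hR1 t ht))]
    · rw [abs_mul, abs_of_nonneg (div_nonneg zero_le_one ha.le)]
  -- uniform bounds on compact intervals
  have hqstep : ∀ T B : ℝ, (∀ s ∈ Set.Icc 0 T, |m s| ≤ B) →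
      ∀ s ∈ Set.Icc 0 T, |q s| ≤ |q 0| + D * B := by
    intro T B hB t ht
    have hB0 : 0 ≤ B := (abs_nonneg _).trans (hB t ht)
    refine (hqle t ht.1).trans (add_le_add ?_ ?_)
    · exact mul_le_of_le_one_right (abs_nonneg _) (by linarith [hR0 t ht.1])
    · have h1 := abs_integral_comp_sub_mul_le (g := m) (B := B) ht.1 le_rfl (fun s _ => hρ0 s) hρi
        fun s hs => hB s ⟨hs.1.le, hs.2.trans ht.2⟩
      rw [sub_self, sub_zero] at h1
      have h2 := integral_le_of_tendsto hρ0 hρi hρK ht.1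
      calc (v / a) * |∫ s in (0 : ℝ)..t, ρ (t - s) * m s|
          ≤ (v / a) * (a / (lam ^ α + a) * B) := by
            refine mul_le_mul_of_nonneg_left (h1.trans ?_) (div_nonneg hv ha.le)
            exact mul_le_mul_of_nonneg_right h2 hB0
        _ = D * B := by rw [← mul_assoc, hDv]
  have hmstep : ∀ T B : ℝ, (∀ s ∈ Set.Icc 0 T, |q s| ≤ B) →
      ∀ s ∈ Set.Icc 0 T, |m s| ≤ |m 0| + (1 / a) * B := by
    intro T B hB t ht
    have hB0 : 0 ≤ B := (abs_nonneg _).trans (hB t ht)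
    refine (hmle t ht.1).trans (add_le_add ?_ ?_)
    · exact mul_le_of_le_one_right (abs_nonneg _) (by linarith [hR0 t ht.1])
    · have h1 := abs_integral_comp_sub_mul_le (g := q) (B := B) ht.1 le_rfl (fun s _ => hr0 s) hri
        fun s hs => hB s ⟨hs.1.le, hs.2.trans ht.2⟩
      rw [sub_self, sub_zero] at h1
      refine mul_le_mul_of_nonneg_left (h1.trans ?_) (by positivity)
      exact mul_le_of_le_one_left hB0 (hR1 t ht.1)
  -- The passage from `m` to `q` has gain `D` and the passage back has gain `1 / a`.
  have hmbd : ∀ s, 0 ≤ s → |m s| ≤ (|m 0| + (1 / a) * |q 0|) / (1 - D / a) := by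
    refine exists_bound_of_contraction hθ1 hmB fun T B _ hB s hs => ?_
    refine (hmstep T _ (hqstep T B hB) s hs).trans (le_of_eq ?_)
    ring
  set M := (|m 0| + (1 / a) * |q 0|) / (1 - D / a) with hM
  have hqbd : ∀ s, 0 ≤ s → |q s| ≤ |q 0| + D * M := fun s hs =>
    hqstep s M (fun u hu => hmbd u hu.1) s (Set.right_mem_Icc.2 hs)
  have hdecay : ∀ (C η : ℝ), 0 < η → ∀ᶠ t in atTop, C * (1 - R t) ≤ η := by
    intro C η hη
    have h := (hrK.const_sub 1).const_mul C
    rw [sub_self, mul_zero] at h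
    exact (h.eventually_lt_const hη).mono fun t ht => ht.le
  -- eventual contraction
  have hM0 : 0 ≤ M := (abs_nonneg _).trans (hmbd 0 le_rfl)
  -- A rate strictly between `D / a` and `1` leaves room for the decaying terms and the convolution
  -- errors.
  refine tendsto_zero_of_eventually_contraction (θ := (1 + D / a) / 2) (B := M + 1)
    (by positivity) (by linarith) (by linarith)
    ((eventually_ge_atTop 0).mono fun t ht => (hmbd t ht).trans (by linarith)) fun β hβ hmβ => ?_
  -- The slack `θ β - (D / a) β`. Half of it pays for the errors in `q` after division by `a`, the
  -- rest for two errors `κ / 4` in `m`.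
  set κ := (1 - D / a) * β / 2 with hκ
  have hκ0 : 0 < κ := by have := sub_pos.2 hθ1; positivity
  have hqβ : ∀ᶠ t in atTop, |q t| ≤ D * β + a * κ / 2 := by
    have hη : 0 < a * κ / 4 := by positivity
    -- The summand `1` keeps the denominator positive when `v = 0`.
    have hη' : 0 < (a * κ / 4) / (v / a + 1) := by positivity
    filter_upwards [hdecay |q 0| _ hη, eventually_ge_atTop 0,
      eventually_abs_integral_comp_sub_mul_le hρ0 hρi hρK hmm hmbd hβ.le hmβ hη'] with t h1 ht h2
    have h3 : (v / a) * |∫ s in (0 : ℝ)..t, ρ (t - s) * m s|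
        ≤ (v / a) * (a / (lam ^ α + a) * β + (a * κ / 4) / (v / a + 1)) :=
      mul_le_mul_of_nonneg_left h2 (div_nonneg hv ha.le)
    have h4 : (v / a) * ((a * κ / 4) / (v / a + 1)) ≤ a * κ / 4 := by
      rw [mul_div_assoc', div_le_iff₀ (by positivity)]
      nlinarith
    have h5 : (v / a) * (a / (lam ^ α + a) * β) = D * β := by rw [← mul_assoc, hDv]
    have := hqle t ht
    linarith
  have hη : 0 < κ / 4 := by positivity
  have hη' : 0 < a * (κ / 4) := by positivity
  filter_upwards [hdecay |m 0| _ hη, eventually_ge_atTop 0,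
    eventually_abs_integral_comp_sub_mul_le hr0 hri hrK hqm hqbd (by positivity) hqβ hη']
    with t h1 ht h2
  have h3 := mul_le_mul_of_nonneg_left h2 (by positivity : 0 ≤ 1 / a)
  have h4 : (1 / a) * (1 * (D * β + a * κ / 2) + a * (κ / 4)) = D / a * β + κ / 2 + κ / 4 := by
    field_simp
  have h5 := hmle t ht
  rw [h4] at h3
  have h6 : (1 + D / a) / 2 * β = D / a * β + κ := by rw [hκ]; ring
  rw [h6]
  linarith

end MomentSystem

/-! ### The Caputo derivative of absolutely continuous functions -/

section Caputo

variable {α : ℝ} {y : ℝ → ℝ}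

lemma ae_restrict_Ioi_of_forall_Ioc {p : ℝ → Prop}
    (h : ∀ n : ℕ, ∀ᵐ t ∂(volume.restrict (Set.Ioc (0 : ℝ) (n + 1))), p t) :
    ∀ᵐ t ∂(volume.restrict (Set.Ioi (0 : ℝ))), p t := by
  rw [ae_restrict_iff' measurableSet_Ioi]
  have h1 : ∀ᵐ t : ℝ, ∀ n : ℕ, t ∈ Set.Ioc (0 : ℝ) (n + 1) → p t :=
    ae_all_iff.2 fun n => (ae_restrict_iff' measurableSet_Ioc).1 (h n)
  filter_upwards [h1] with t ht ht0
  obtain ⟨n, hn⟩ := exists_nat_ge t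
  exact ht n ⟨ht0, hn.trans (by linarith)⟩

lemma caputoDeriv_of_lt_one (hα1 : α < 1) (t : ℝ) :
    caputoDeriv α y t = ∫ u in (0 : ℝ)..t, fracKernel (1 - α) (t - u) * deriv y u := by
  rw [caputoDeriv, if_neg hα1.ne, ← intervalIntegral.integral_const_mul]
  refine intervalIntegral.integral_congr fun u _ => ?_
  simp only [fracKernel]
  rw [show 1 - α - 1 = -α by ring]
  ring

lemma LocallyAC.integrableOn_deriv (hy : LocallyAC y) {t : ℝ} (ht : 0 < t) :
    IntegrableOn (deriv y) (Set.Ioc 0 t) :=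
  (intervalIntegrable_iff_integrableOn_Ioc_of_le ht.le).1 (hy t ht).intervalIntegrable_deriv

lemma LocallyAC.continuousOn (hy : LocallyAC y) {t : ℝ} (ht : 0 < t) :
    ContinuousOn y (Set.Icc 0 t) := by
  have := (hy t ht).continuousOn
  rwa [Set.uIcc_of_le ht.le] at this

lemma LocallyAC.ae_differentiableAt (hy : LocallyAC y) :
    ∀ᵐ t ∂(volume.restrict (Set.Ioi (0 : ℝ))), DifferentiableAt ℝ y t := by
  refine ae_restrict_Ioi_of_forall_Ioc fun n => ?_
  have hn : (0 : ℝ) < n + 1 := by positivity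
  rw [ae_restrict_iff' measurableSet_Ioc]
  filter_upwards [(hy (n + 1) hn).ae_differentiableAt] with t ht ht'
  refine ht ?_
  rw [Set.uIcc_of_le hn.le]
  exact Set.Ioc_subset_Icc_self ht'

lemma integral_fracKernel_mul_one_sub (hα0 : 0 < α) (hα1 : α < 1) {s : ℝ} (hs : 0 < s) :
    ∫ u in (0 : ℝ)..s, fracKernel α (s - u) * fracKernel (1 - α) u = 1 := by
  rw [integral_fracKernel_mul hα0 (sub_pos.2 hα1) hs, add_sub_cancel, fracKernel_one]

/-- The orders `α` and `1 - α` convolve to the constant `1`, so the triangle integral is controlled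
by the integral of `|y'|` alone. -/
lemma LocallyAC.ae_intervalIntegrable (hy : LocallyAC y) (hα0 : 0 < α) (hα1 : α < 1) :
    ∀ᵐ t ∂(volume.restrict (Set.Ioi (0 : ℝ))),
      IntervalIntegrable (fun u => fracKernel (1 - α) (t - u) * deriv y u) volume 0 t := by
  have h1α : 0 < 1 - α := sub_pos.2 hα1
  refine ae_restrict_Ioi_of_forall_Ioc fun n => ?_
  have hn : (0 : ℝ) < n + 1 := by positivity
  have hd := hy.integrableOn_deriv hn
  refine ae_integrable_volterra (f := fracKernel α) (c := fun _ => 1) (measurable_fracKernel _)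
    (measurable_fracKernel _) (fun s hs => fracKernel_nonneg hα0 hs.le)
    (fun s hs => fracKernel_nonneg h1α hs.le) hd.aestronglyMeasurable
    (fun s hs _ => intervalIntegrable_fracKernel_mul hα0 h1α hs)
    (fun s hs _ => integral_fracKernel_mul_one_sub hα0 hα1 hs) ?_
    (fun s hs => (fracKernel_pos hα0 hs).ne')
  simpa only [one_mul] using hd

/-- Fractional integration inverts the Caputo derivative. -/
lemma LocallyAC.integral_fracKernel_mul_caputoDeriv (hy : LocallyAC y) (hα0 : 0 < α) (hα1 : α ≤ 1)
    {t : ℝ} (ht : 0 ≤ t) :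
    ∫ u in (0 : ℝ)..t, fracKernel α (t - u) * caputoDeriv α y u = y t - y 0 := by
  rcases ht.eq_or_lt with rfl | ht
  · simp
  have hftc := (hy t ht).integral_deriv_eq_sub
  rcases hα1.eq_or_lt with rfl | hα1
  · simpa only [fracKernel_one, one_mul, caputoDeriv, if_true] using hftc
  have h1α : 0 < 1 - α := sub_pos.2 hα1
  have hd := hy.integrableOn_deriv ht
  -- The composed kernel is `1`, so what remains is the integral of `y'`.
  have h := integral_volterra_assoc (f := fracKernel α) (g := fracKernel (1 - α)) (h := deriv y)
    (c := fun _ => 1) (measurable_fracKernel _)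
    (measurable_fracKernel _) (fun s hs => fracKernel_nonneg hα0 hs.le)
    (fun s hs => fracKernel_nonneg h1α hs.le) hd.aestronglyMeasurable
    (fun s hs _ => intervalIntegrable_fracKernel_mul hα0 h1α hs)
    (fun s hs _ => integral_fracKernel_mul_one_sub hα0 hα1 hs)
    (by simpa only [one_mul] using hd) ht.le
  simp only [one_mul] at h
  simp only [caputoDeriv_of_lt_one hα1]
  rw [h, hftc]

lemma LocallyAC.const_mul (hy : LocallyAC y) (c : ℝ) : LocallyAC fun s => c * y s :=
  fun T hT => (hy T hT).const_mul c

lemma LocallyAC.sum {ι : Type*} (s : Finset ι) {z : ι → ℝ → ℝ} (hz : ∀ i, LocallyAC (z i)) :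
    LocallyAC fun t => ∑ i ∈ s, z i t := by
  classical
  intro T hT
  induction s using Finset.induction_on with
  | empty =>
    have h : LipschitzOnWith 0 (fun _ : ℝ => (0 : ℝ)) (Set.uIcc 0 T) :=
      (LipschitzWith.const 0).lipschitzOnWith
    simpa using h.absolutelyContinuousOnInterval
  | insert i s hi ih =>
    simp only [Finset.sum_insert hi]
    exact (hz i T hT).add ih

lemma ae_deriv_linear_combination {ι : Type*} [Fintype ι] (c : ι → ℝ) {z : ι → ℝ → ℝ}
    (hz : ∀ i, LocallyAC (z i)) :
    ∀ᵐ t ∂(volume.restrict (Set.Ioi (0 : ℝ))),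
      deriv (fun s => ∑ i, c i * z i s) t = ∑ i, c i * deriv (z i) t := by
  filter_upwards [ae_all_iff.2 fun i => (hz i).ae_differentiableAt] with t ht
  rw [deriv_fun_sum fun i _ => (ht i).const_mul (c i)]
  exact Finset.sum_congr rfl fun i _ => deriv_const_mul _ (ht i)

/-- The Caputo derivative is linear, at almost every time. -/
lemma ae_caputoDeriv_linear_combination (hα0 : 0 < α) (hα1 : α ≤ 1) {ι : Type*} [Fintype ι]
    (c : ι → ℝ) {z : ι → ℝ → ℝ} (hz : ∀ i, LocallyAC (z i)) :
    ∀ᵐ t ∂(volume.restrict (Set.Ioi (0 : ℝ))),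
      caputoDeriv α (fun s => ∑ i, c i * z i s) t = ∑ i, c i * caputoDeriv α (z i) t := by
  have hd := ae_deriv_linear_combination c hz
  rcases hα1.eq_or_lt with rfl | hα1
  · simpa only [caputoDeriv, if_true] using hd
  filter_upwards [ae_all_iff.2 fun i => (hz i).ae_intervalIntegrable hα0 hα1,
    ae_restrict_mem measurableSet_Ioi] with t ht ht0
  simp only [caputoDeriv_of_lt_one hα1]
  have h1 : ∫ u in (0 : ℝ)..t, fracKernel (1 - α) (t - u) * deriv (fun s => ∑ i, c i * z i s) u
      = ∫ u in (0 : ℝ)..t, ∑ i, c i * (fracKernel (1 - α) (t - u) * deriv (z i) u) := by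
    refine intervalIntegral.integral_congr_ae ?_
    rw [ae_restrict_iff' measurableSet_Ioi] at hd
    filter_upwards [hd] with u hu hut
    rw [Set.uIoc_of_le (le_of_lt ht0)] at hut
    rw [hu hut.1, Finset.mul_sum]
    exact Finset.sum_congr rfl fun i _ => by ring
  rw [h1, intervalIntegral.integral_finsetSum fun i _ => (ht i).const_mul _]
  simp only [intervalIntegral.integral_const_mul]

end Caputo

/-! ### Fractional Grönwall inequality -/

section Gronwall

lemma integral_exp_mul_fracKernel_le {α c t : ℝ} (hα : 0 < α) (hc : 0 < c) (ht : 0 ≤ t) :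
    ∫ u in (0 : ℝ)..t, Real.exp (-(c * u)) * fracKernel α u ≤ (c ^ α)⁻¹ := by
  rw [intervalIntegral.integral_of_le ht, ← integral_exp_mul_fracKernel hα hc]
  refine setIntegral_mono_set (integrableOn_exp_mul_fracKernel hα hc) ?_
    (LE.le.eventuallyLE Set.Ioc_subset_Ioi_self)
  filter_upwards [ae_restrict_mem measurableSet_Ioi] with u hu
  exact mul_nonneg (Real.exp_pos _).le (fracKernel_nonneg hα (le_of_lt hu))

/-- A fractional Grönwall inequality, with a constant independent of the function. -/
lemma fractional_gronwall {α K T : ℝ} (C : ℝ) (hα : 0 < α) (hK : 0 < K) (hT : 0 < T) (hC : 0 ≤ C) :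
    ∃ G : ℝ, 0 ≤ G ∧ ∀ (Z : ℝ → ℝ) (z₀ : ℝ), 0 ≤ z₀ → ContinuousOn Z (Set.Icc 0 T) →
      (∀ t ∈ Set.Icc 0 T, 0 ≤ Z t) →
      (∀ t ∈ Set.Icc 0 T, Z t ≤ z₀ + ∫ u in (0 : ℝ)..t, fracKernel α (t - u) * (K * Z u + C)) →
      ∀ t ∈ Set.Icc 0 T, Z t ≤ G * (z₀ + 1) := by
  -- With `c ^ α = 2 K` the weighted kernel has mass at most `1 / (2 K)`, so in the norm `sup exp
  -- (-c s) Z s` the linear term contributes at most half of the norm and is absorbed.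
  have hc : 0 < (2 * K) ^ α⁻¹ := Real.rpow_pos_of_pos (by positivity) _
  have hcα : ((2 * K) ^ α⁻¹) ^ α = 2 * K := by
    rw [← Real.rpow_mul (by positivity), inv_mul_cancel₀ hα.ne', Real.rpow_one]
  set c := (2 * K) ^ α⁻¹
  -- Absorption gives `W ≤ 2 z₀ + C / K`; the exponential undoes the weight.
  refine ⟨Real.exp (c * T) * (2 + C / K), by positivity, fun Z z₀ hz₀ hZc hZ0 hZ => ?_⟩
  have hwc : ContinuousOn (fun s => Real.exp (-(c * s)) * Z s) (Set.Icc 0 T) :=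
    ContinuousOn.mul (by fun_prop) hZc
  obtain ⟨τ, hτ, hmax⟩ := isCompact_Icc.exists_isMaxOn (Set.nonempty_Icc.2 hT.le) hwc
  set W := Real.exp (-(c * τ)) * Z τ with hW
  have hmax : ∀ s ∈ Set.Icc 0 T, Real.exp (-(c * s)) * Z s ≤ W := fun s hs => hmax hs
  have hW0 : 0 ≤ W := mul_nonneg (Real.exp_pos _).le (hZ0 τ hτ)
  have hexp1 : ∀ s, 0 ≤ s → Real.exp (-(c * s)) ≤ 1 := fun s hs => by
    refine Real.exp_le_one_iff.2 ?_
    have := mul_nonneg hc.le hs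
    linarith
  have hki : ∀ t, 0 ≤ t →
      IntervalIntegrable (fun u => Real.exp (-(c * u)) * fracKernel α u) volume 0 t :=
    fun t ht => (intervalIntegrable_iff_integrableOn_Ioc_of_le ht).2
      ((integrableOn_exp_mul_fracKernel hα hc).mono_set Set.Ioc_subset_Ioi_self)
  have hb := abs_integral_comp_sub_mul_le (k := fun u => Real.exp (-(c * u)) * fracKernel α u)
    (g := fun u => K * (Real.exp (-(c * u)) * Z u) + C * Real.exp (-(c * u))) (t := τ) (B := K * W + C)
    hτ.1 le_rfl
    (fun s hs => mul_nonneg (Real.exp_pos _).le (fracKernel_nonneg hα hs)) hki (fun s hs => by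
      have hs' : s ∈ Set.Icc 0 T := ⟨hs.1.le, hs.2.trans hτ.2⟩
      have := hZ0 s hs'
      rw [abs_of_nonneg (by positivity)]
      refine add_le_add (mul_le_mul_of_nonneg_left (hmax s hs') hK.le) ?_
      exact mul_le_of_le_one_right hC (hexp1 s hs'.1))
  rw [sub_self, sub_zero] at hb
  have hmass := integral_exp_mul_fracKernel_le hα hc hτ.1
  rw [hcα] at hmass
  have h1 : Real.exp (-(c * τ)) * ∫ u in (0 : ℝ)..τ, fracKernel α (τ - u) * (K * Z u + C)
      = ∫ u in (0 : ℝ)..τ, Real.exp (-(c * (τ - u))) * fracKernel α (τ - u) *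
        (K * (Real.exp (-(c * u)) * Z u) + C * Real.exp (-(c * u))) := by
    rw [← intervalIntegral.integral_const_mul]
    refine intervalIntegral.integral_congr fun u _ => ?_
    have : Real.exp (-(c * τ)) = Real.exp (-(c * (τ - u))) * Real.exp (-(c * u)) := by
      rw [← Real.exp_add]; congr 1; ring
    rw [this]; ring
  have h2 : W ≤ z₀ + (2 * K)⁻¹ * (K * W + C) := by
    have h3 := mul_le_mul_of_nonneg_left (hZ τ hτ) (Real.exp_pos (-(c * τ))).le
    rw [mul_add, h1] at h3
    refine h3.trans (add_le_add ?_ ?_)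
    · exact mul_le_of_le_one_left hz₀ (hexp1 τ hτ.1)
    · refine (le_abs_self _).trans (hb.trans ?_)
      exact mul_le_mul_of_nonneg_right hmass (by positivity)
  have h4 : W ≤ (2 + C / K) * (z₀ + 1) := by
    have h5 : (2 * K)⁻¹ * (K * W + C) = W / 2 + C / K / 2 := by field_simp
    rw [h5] at h2
    have h6 : 0 ≤ C / K := by positivity
    nlinarith [mul_nonneg h6 hz₀]
  intro t ht
  have h7 := (hmax t ht).trans h4
  rw [Real.exp_neg, inv_mul_le_iff₀ (Real.exp_pos _)] at h7
  refine h7.trans ?_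
  rw [mul_assoc]
  refine mul_le_mul_of_nonneg_right (Real.exp_le_exp.2 ?_) (by positivity)
  exact mul_le_mul_of_nonneg_left ht.2 hc.le

end Gronwall

/-! ### Pathwise analysis of the star system -/

section StarPath

variable {α ω ε A ν σ : ℝ} {N : ℕ} {X : Fin (N + 1) → ℝ → ℝ} {z : ℝ → ℝ}

lemma abs_le_add_integral_of_caputoDeriv {y Z : ℝ → ℝ} {K C T : ℝ} (hα0 : 0 < α) (hα1 : α ≤ 1)
    (hy : LocallyAC y) (hZ : ContinuousOn Z (Set.Icc 0 T))
    (hb : ∀ᵐ t ∂(volume.restrict (Set.Ioi (0 : ℝ))), |caputoDeriv α y t| ≤ K * Z t + C)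
    {t : ℝ} (ht : t ∈ Set.Icc 0 T) :
    |y t| ≤ |y 0| + ∫ u in (0 : ℝ)..t, fracKernel α (t - u) * (K * Z u + C) := by
  rcases ht.1.eq_or_lt with h0 | h0
  · rw [← h0]; simp
  have h := hy.integral_fracKernel_mul_caputoDeriv hα0 hα1 ht.1
  have hk : IntervalIntegrable (fun u => fracKernel α (t - u)) volume 0 t := by
    simpa using ((intervalIntegrable_fracKernel hα0 h0).comp_sub_left t).symm
  have hZ' : ContinuousOn (fun u => K * Z u + C) (Set.uIcc 0 t) := by
    rw [Set.uIcc_of_le ht.1]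
    have := hZ.mono (Set.Icc_subset_Icc_right ht.2)
    fun_prop
  have h1 : |∫ u in (0 : ℝ)..t, fracKernel α (t - u) * caputoDeriv α y u|
      ≤ ∫ u in (0 : ℝ)..t, fracKernel α (t - u) * (K * Z u + C) := by
    rw [← Real.norm_eq_abs]
    refine intervalIntegral.norm_integral_le_of_norm_le ht.1 ?_ (hk.mul_continuousOn hZ')
    rw [ae_restrict_iff' measurableSet_Ioi] at hb
    filter_upwards [hb] with u hu hut
    have hk0 := fracKernel_nonneg hα0 (sub_nonneg.2 hut.2)
    rw [norm_mul, Real.norm_eq_abs, Real.norm_eq_abs, abs_of_nonneg hk0]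
    exact mul_le_mul_of_nonneg_left (hu hut.1) hk0
  have h2 : y t = y 0 + (y t - y 0) := by ring
  rw [h2, ← h]
  exact (abs_add_le _ _).trans (by gcongr)

lemma abs_caputoDeriv_le_of_star (hω : 0 ≤ ω) (hz : ∀ t, 0 ≤ t → |z t| ≤ σ)
    (hmain : ∀ᵐ t ∂(volume.restrict (Set.Ioi (0 : ℝ))),
      caputoDeriv α (X 0) t + (ω + z t) * X 0 t
        = ε * ∑ k : Fin N, (X k.succ t - X 0 t) + A * Real.sin (ν * t))
    (hgen : ∀ k : Fin N, ∀ᵐ t ∂(volume.restrict (Set.Ioi (0 : ℝ))),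
      caputoDeriv α (X k.succ) t + (ω + z t) * X k.succ t
        = ε * (X 0 t - X k.succ t) + A * Real.sin (ν * t)) (i : Fin (N + 1)) :
    ∀ᵐ t ∂(volume.restrict (Set.Ioi (0 : ℝ))), |caputoDeriv α (X i) t|
      ≤ (ω + σ + |ε| * (N + 2)) * ∑ j, |X j t| + |A| := by
  have hsin : ∀ t, |A * Real.sin (ν * t)| ≤ |A| := fun t => by
    rw [abs_mul]
    exact mul_le_of_le_one_right (abs_nonneg _) (Real.abs_sin_le_one _)
  have hle : ∀ t j, |X j t| ≤ ∑ j, |X j t| := fun t j =>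
    Finset.single_le_sum (f := fun j => |X j t|) (fun _ _ => abs_nonneg _) (Finset.mem_univ j)
  have hωz : ∀ t, 0 ≤ t → ∀ j, |(ω + z t) * X j t| ≤ (ω + σ) * ∑ j, |X j t| := by
    intro t ht j
    rw [abs_mul]
    refine mul_le_mul ((abs_add_le _ _).trans ?_) (hle t j) (abs_nonneg _) ?_
    · rw [abs_of_nonneg hω]; linarith [hz t ht]
    · linarith [hz t ht, abs_nonneg (z t)]
  -- The factor `N + 2` serves both kinds of particle: the hub coupling needs `N + 1`, a general
  -- particle needs `2`.
  have key : ∀ t, 0 ≤ t → ∀ D c j, D + (ω + z t) * X j t = ε * c + A * Real.sin (ν * t) →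
      |c| ≤ (N + 2) * ∑ j, |X j t| →
      |D| ≤ (ω + σ + |ε| * (N + 2)) * ∑ j, |X j t| + |A| := by
    intro t ht D c j hD hc
    have h1 : D = ε * c - (ω + z t) * X j t + A * Real.sin (ν * t) := by linarith
    have h2 : |ε * c| ≤ |ε| * ((N + 2) * ∑ j, |X j t|) := by
      rw [abs_mul]; exact mul_le_mul_of_nonneg_left hc (abs_nonneg _)
    rw [h1]
    refine (abs_add_le _ _).trans ((add_le_add (abs_sub _ _) (hsin t)).trans ?_)
    have := hωz t ht j
    linarith
  refine Fin.cases ?_ (fun k => ?_) i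
  · filter_upwards [hmain, ae_restrict_mem measurableSet_Ioi] with t h ht
    refine key t (le_of_lt ht) _ _ 0 h ?_
    refine (Finset.abs_sum_le_sum_abs _ _).trans ?_
    have h1 : ∑ k : Fin N, |X k.succ t - X 0 t| ≤ ∑ k : Fin N, (|X k.succ t| + ∑ j, |X j t|) :=
      Finset.sum_le_sum fun k _ => (abs_sub _ _).trans (by gcongr; exact hle t 0)
    have h2 : ∑ k : Fin N, |X k.succ t| ≤ ∑ j, |X j t| := by
      rw [Fin.sum_univ_succ (fun j => |X j t|)]
      linarith [abs_nonneg (X 0 t)]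
    rw [Finset.sum_add_distrib, Finset.sum_const, Finset.card_univ, Fintype.card_fin,
      nsmul_eq_mul] at h1
    linarith [(abs_nonneg _).trans (hle t 0)]
  · filter_upwards [hgen k, ae_restrict_mem measurableSet_Ioi] with t h ht
    refine key t (le_of_lt ht) _ _ k.succ h ?_
    refine (abs_sub _ _).trans ((add_le_add (hle t _) (hle t _)).trans ?_)
    nlinarith [(abs_nonneg _).trans (hle t 0), Nat.cast_nonneg (α := ℝ) N]

/-- Paths of a solution of the star system on `[0, T]` are bounded linearly by their initial
values, with a constant that depends on the coefficients only. -/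
lemma exists_star_path_bound (hα0 : 0 < α) (hα1 : α ≤ 1) (hω : 0 ≤ ω) (hσ : 0 < σ) (ε A : ℝ) (N : ℕ)
    {T : ℝ} (hT : 0 < T) :
    ∃ G : ℝ, 0 ≤ G ∧ ∀ (X : Fin (N + 1) → ℝ → ℝ), (∀ i, LocallyAC (X i)) →
      (∀ i, ∀ᵐ t ∂(volume.restrict (Set.Ioi (0 : ℝ))), |caputoDeriv α (X i) t|
        ≤ (ω + σ + |ε| * (N + 2)) * ∑ j, |X j t| + |A|) →
      ∀ t ∈ Set.Icc 0 T, ∑ i, |X i t| ≤ G * (∑ i, |X i 0| + 1) := by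
  set K := ω + σ + |ε| * (N + 2) with hK
  have hK0 : 0 < K := by positivity
  have hN : (0 : ℝ) < N + 1 := by positivity
  -- Summing the `N + 1` scalar inequalities multiplies both constants by `N + 1`. The constant is
  -- fixed before the path, which later makes the bound an integrable random variable.
  obtain ⟨G, hG0, hG⟩ := fractional_gronwall (α := α) (K := (N + 1) * K) (T := T)
    ((N + 1) * |A|) hα0 (by positivity) hT (by positivity)
  refine ⟨G, hG0, fun X hX hD => ?_⟩
  have hZc : ContinuousOn (fun t => ∑ i, |X i t|) (Set.Icc 0 T) :=
    continuousOn_finsetSum _ fun i _ => ((hX i).continuousOn hT).abs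
  refine hG (fun t => ∑ i, |X i t|) _ (Finset.sum_nonneg fun i _ => abs_nonneg _) hZc
    (fun t _ => Finset.sum_nonneg fun i _ => abs_nonneg _) fun t ht => ?_
  have h1 := Finset.sum_le_sum fun i (_ : i ∈ Finset.univ) =>
    abs_le_add_integral_of_caputoDeriv hα0 hα1 (hX i) hZc (hD i) ht
  refine h1.trans (le_of_eq ?_)
  rw [Finset.sum_add_distrib, Finset.sum_const, Finset.card_univ, Fintype.card_fin, nsmul_eq_mul,
    ← intervalIntegral.integral_const_mul]
  congr 1
  refine intervalIntegral.integral_congr fun u _ => ?_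
  push_cast
  ring

/-- The coefficients of the deviation of the main particle from the mean field. -/
noncomputable def deviationCoeff (N : ℕ) (i : Fin (N + 1)) : ℝ :=
  (if i = 0 then 1 else 0) - 1 / ((N : ℝ) + 1)

lemma sum_deviationCoeff_mul (c : Fin (N + 1) → ℝ) :
    ∑ i, deviationCoeff N i * c i = c 0 - (∑ i, c i) / ((N : ℝ) + 1) := by
  simp only [deviationCoeff, sub_mul, Finset.sum_sub_distrib, ite_mul, one_mul, zero_mul,
    Finset.sum_ite_eq', Finset.mem_univ, if_true, ← Finset.mul_sum]
  ring

lemma LocallyAC.deviation (hX : ∀ i, LocallyAC (X i)) :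
    LocallyAC fun t => X 0 t - (∑ i, X i t) / ((N : ℝ) + 1) := by
  have h := LocallyAC.sum Finset.univ fun i => (hX i).const_mul (deviationCoeff N i)
  simpa only [sum_deviationCoeff_mul] using h

/-- The deviation coefficients sum to zero, which removes the force. The couplings sum to zero over
all particles, so only the hub's own coupling is left, and it equals `-ε (N + 1)` times the
deviation. -/
lemma ae_caputoDeriv_deviation (hα0 : 0 < α) (hα1 : α ≤ 1) (hX : ∀ i, LocallyAC (X i))
    (hmain : ∀ᵐ t ∂(volume.restrict (Set.Ioi (0 : ℝ))),
      caputoDeriv α (X 0) t + (ω + z t) * X 0 t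
        = ε * ∑ k : Fin N, (X k.succ t - X 0 t) + A * Real.sin (ν * t))
    (hgen : ∀ k : Fin N, ∀ᵐ t ∂(volume.restrict (Set.Ioi (0 : ℝ))),
      caputoDeriv α (X k.succ) t + (ω + z t) * X k.succ t
        = ε * (X 0 t - X k.succ t) + A * Real.sin (ν * t)) :
    ∀ᵐ t ∂(volume.restrict (Set.Ioi (0 : ℝ))),
      caputoDeriv α (fun s => X 0 s - (∑ i, X i s) / ((N : ℝ) + 1)) t
        + (ω + z t + ε * ((N : ℝ) + 1)) * (X 0 t - (∑ i, X i t) / ((N : ℝ) + 1)) = 0 := by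
  have hlin := ae_caputoDeriv_linear_combination hα0 hα1 (deviationCoeff N) hX
  simp only [sum_deviationCoeff_mul] at hlin
  filter_upwards [hlin, hmain, ae_all_iff.2 hgen] with t h hm hg
  have hN : (N : ℝ) + 1 ≠ 0 := by positivity
  have hsum : ∑ k : Fin N, caputoDeriv α (X k.succ) t = ∑ k : Fin N,
      (ε * (X 0 t - X k.succ t) + A * Real.sin (ν * t) - (ω + z t) * X k.succ t) :=
    Finset.sum_congr rfl fun k _ => by linarith [hg k]
  simp only [Finset.sum_sub_distrib, Finset.sum_add_distrib, ← Finset.mul_sum, Finset.sum_const,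
    Finset.card_univ, Fintype.card_fin, nsmul_eq_mul] at hsum hm
  rw [h, Fin.sum_univ_succ, Fin.sum_univ_succ, hsum]
  set Y := ∑ k : Fin N, X k.succ t
  have hm' : caputoDeriv α (X 0) t
      = ε * (Y - N * X 0 t) + A * Real.sin (ν * t) - (ω + z t) * X 0 t := by linarith
  rw [hm']
  field_simp
  ring

end StarPath

/-! ### Correlation splitting for the noise -/

section Noise

variable {Ω : Type*} {mΩ : MeasurableSpace Ω} {P : Measure Ω} {𝓕 : Filtration ℝ mΩ}
  {σ lam : ℝ} {ξ : ℝ → Ω → ℝ}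

lemma IsTelegraphNoise.measurable (hξ : IsTelegraphNoise P 𝓕 σ lam ξ) {t : ℝ} (ht : 0 ≤ t) :
    Measurable (ξ t) := (hξ.adapted t ht).mono (𝓕.le t) le_rfl

lemma IsTelegraphNoise.abs_eq (hξ : IsTelegraphNoise P 𝓕 σ lam ξ) (hσ : 0 < σ) {t : ℝ}
    (ht : 0 ≤ t) (w : Ω) : |ξ t w| = σ := by
  rcases hξ.values t ht w with h | h <;> rw [h]
  · exact abs_of_pos hσ
  · rw [abs_neg, abs_of_pos hσ]

lemma IsTelegraphNoise.mul_self (hξ : IsTelegraphNoise P 𝓕 σ lam ξ) {t : ℝ}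
    (ht : 0 ≤ t) (w : Ω) : ξ t w * ξ t w = σ ^ 2 := by
  rcases hξ.values t ht w with h | h <;> rw [h] <;> ring

lemma IsTelegraphNoise.integrable_mul (hξ : IsTelegraphNoise P 𝓕 σ lam ξ) (hσ : 0 < σ) {t : ℝ}
    (ht : 0 ≤ t) {G : Ω → ℝ} (hG : Integrable G P) : Integrable (fun w => ξ t w * G w) P :=
  hG.bdd_mul (c := σ) (hξ.measurable ht).aestronglyMeasurable
    (Eventually.of_forall fun w => by rw [Real.norm_eq_abs, hξ.abs_eq hσ ht w])

variable [IsProbabilityMeasure P]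

lemma IsTelegraphNoise.integrable (hξ : IsTelegraphNoise P 𝓕 σ lam ξ) (hσ : 0 < σ) {t : ℝ}
    (ht : 0 ≤ t) : Integrable (ξ t) P := by
  simpa using hξ.integrable_mul hσ ht (integrable_const (1 : ℝ))

/-- The conditional mean of the noise is an affine function of its present value. -/
lemma IsTelegraphNoise.exists_condExp_eq (hξ : IsTelegraphNoise P 𝓕 σ lam ξ) (hσ : 0 < σ) {s t : ℝ}
    (hs : 0 ≤ s) (hst : s ≤ t) : ∃ c₀ c₁ : ℝ, P[ξ t|𝓕 s] =ᵐ[P] fun w => c₀ + c₁ * ξ s w := by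
  have ht := hs.trans hst
  have hmeas : MeasurableSet (ξ t ⁻¹' {σ}) := hξ.measurable ht (measurableSet_singleton σ)
  -- A two-valued variable is affine in one indicator, so the Markov property for events suffices.
  have hξt : ξ t = (2 * σ) • ((ξ t ⁻¹' {σ}).indicator fun _ => (1 : ℝ)) + fun _ => -σ := by
    ext w
    by_cases h : ξ t w = σ
    · simp [h]; ring
    · rcases hξ.values t ht w with h' | h'
      · exact absurd h' h
      · have hne : -σ ≠ σ := by intro hh; linarith
        simp [h', hne]
  have hint : Integrable ((ξ t ⁻¹' {σ}).indicator fun _ => (1 : ℝ)) P :=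
    (integrable_const _).indicator hmeas
  have h1 : P[ξ t|𝓕 s] =ᵐ[P] (2 * σ) • P⟦ξ t ⁻¹' {σ}|𝓕 s⟧ + fun _ => -σ := by
    nth_rewrite 1 [hξt]
    refine (condExp_add (hint.smul _) (integrable_const _) _).trans ?_
    rw [condExp_const (𝓕.le s)]
    exact (condExp_smul _ _ _).add (ae_eq_refl _)
  have h2 := hξ.markov s t hs hst {σ} (measurableSet_singleton σ)
  obtain ⟨g, hg, hgeq⟩ := (stronglyMeasurable_condExp (μ := P)
    (m := MeasurableSpace.comap (ξ s) inferInstance)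
    (f := (ξ t ⁻¹' {σ}).indicator fun _ => (1 : ℝ))).measurable.exists_eq_measurable_comp
  -- Affine interpolation of `2 σ g - σ` at the two possible values `σ` and `-σ` of `ξ s`.
  refine ⟨σ * (g σ + g (-σ)) - σ, g σ - g (-σ), ?_⟩
  filter_upwards [h1, h2] with w hw1 hw2
  rw [hw1, Pi.add_apply, Pi.smul_apply, hw2, hgeq, Function.comp_apply, smul_eq_mul]
  rcases hξ.values s hs w with h | h <;> rw [h] <;> ring

/-- Correlation splitting for the dichotomous noise: conditioning on the past up to time `s`
replaces `ξ t` by `exp (-lam (t - s)) ξ s`. -/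
lemma IsTelegraphNoise.integral_mul (hξ : IsTelegraphNoise P 𝓕 σ lam ξ) (hσ : 0 < σ) {s t : ℝ}
    (hs : 0 ≤ s) (hst : s ≤ t) {G : Ω → ℝ} (hGm : Measurable[𝓕 s] G) (hG : Integrable G P) :
    ∫ w, ξ t w * G w ∂P = Real.exp (-(lam * (t - s))) * ∫ w, ξ s w * G w ∂P := by
  have ht := hs.trans hst
  obtain ⟨c₀, c₁, hc⟩ := hξ.exists_condExp_eq hσ hs hst
  have key : ∀ H : Ω → ℝ, Measurable[𝓕 s] H → Integrable H P →
      ∫ w, ξ t w * H w ∂P = c₀ * ∫ w, H w ∂P + c₁ * ∫ w, ξ s w * H w ∂P := by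
    intro H hHm hH
    have h1 := condExp_mul_of_stronglyMeasurable_right (μ := P) (f := ξ t) hHm.stronglyMeasurable
      (hξ.integrable_mul hσ ht hH) (hξ.integrable hσ ht)
    calc ∫ w, ξ t w * H w ∂P = ∫ w, (P[ξ t * H|𝓕 s]) w ∂P := (integral_condExp (𝓕.le s)).symm
      _ = ∫ w, (c₀ * H w + c₁ * (ξ s w * H w)) ∂P := by
          refine integral_congr_ae ?_
          filter_upwards [h1, hc] with w hw1 hw2
          rw [hw1, Pi.mul_apply, hw2]; ring
      _ = _ := by
          rw [integral_add (hH.const_mul _) ((hξ.integrable_mul hσ hs hH).const_mul _),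
            integral_const_mul, integral_const_mul]
  -- The coefficients are found by testing: `H = 1` with the zero mean gives `c₀`, and `H = ξ s`
  -- with the correlation gives `c₁`.
  have hc₀ : c₀ = 0 := by
    have h := key (fun _ => 1) measurable_const (integrable_const _)
    simp only [mul_one, hξ.mean t ht, hξ.mean s hs] at h
    simpa using h.symm
  have hc₁ : c₁ = Real.exp (-(lam * (t - s))) := by
    have h := key (ξ s) (hξ.adapted s hs) (hξ.integrable hσ hs)
    rw [hξ.correlation s t hs ht, hξ.correlation s s hs hs, hc₀, sub_self, abs_zero, mul_zero,
      Real.exp_zero, abs_of_nonneg (sub_nonneg.2 hst)] at h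
    have hσ2 : σ ^ 2 ≠ 0 := by positivity
    have h' : σ ^ 2 * Real.exp (-lam * (t - s)) = σ ^ 2 * c₁ := by linarith
    rw [← mul_left_cancel₀ hσ2 h', neg_mul]
  rw [key G hGm hG, hc₀, hc₁]; ring

end Noise

/-! ### Joint measurability and Fubini -/

section JointMeasurability

variable {Ω : Type*} {mΩ : MeasurableSpace Ω} {P : Measure Ω}

/-- The grid point of mesh `1 / (n + 1)` following `u`. -/
noncomputable def gridPoint (n : ℕ) (u : ℝ) : ℝ := ((⌊((n : ℝ) + 1) * u⌋₊ : ℝ) + 1) / ((n : ℝ) + 1)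

lemma lt_gridPoint (n : ℕ) (u : ℝ) : u < gridPoint n u := by
  rw [gridPoint, lt_div_iff₀ (by positivity), mul_comm]
  exact Nat.lt_floor_add_one _

lemma gridPoint_le (n : ℕ) {u : ℝ} (hu : 0 ≤ u) : gridPoint n u ≤ u + 1 / ((n : ℝ) + 1) := by
  have hn : (0 : ℝ) < n + 1 := by positivity
  rw [gridPoint, add_div]
  gcongr
  rw [div_le_iff₀ hn, mul_comm]
  exact Nat.floor_le (by positivity)

lemma tendsto_gridPoint {u : ℝ} (hu : 0 ≤ u) :
    Tendsto (fun n => gridPoint n u) atTop (𝓝[≥] u) := by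
  refine tendsto_nhdsWithin_iff.2 ⟨?_, Eventually.of_forall fun n => (lt_gridPoint n u).le⟩
  refine tendsto_of_tendsto_of_tendsto_of_le_of_le tendsto_const_nhds ?_
    (fun n => (lt_gridPoint n u).le) (fun n => gridPoint_le n hu)
  simpa using (tendsto_one_div_add_atTop_nhds_zero_nat (𝕜 := ℝ)).const_add u

/-- A process with almost surely right-continuous paths is jointly measurable. -/
lemma aestronglyMeasurable_uncurry_of_rightContinuous {Y : ℝ → Ω → ℝ}
    (hm : ∀ t, 0 ≤ t → Measurable (Y t))
    (hc : ∀ᵐ w ∂P, ∀ t, 0 ≤ t → ContinuousWithinAt (fun s => Y s w) (Set.Ici t) t) (T : ℝ) :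
    AEStronglyMeasurable (Function.uncurry Y) ((volume.restrict (Set.Ioc 0 T)).prod P) := by
  refine aestronglyMeasurable_of_tendsto_ae atTop
    (f := fun n (p : ℝ × Ω) => Y (gridPoint n p.1) p.2) (fun n => ?_) ?_
  -- Each approximant factors through a countable index. The natural-number floor keeps all sampling
  -- times nonnegative, where measurability is assumed.
  · have h1 : Measurable fun p : ℕ × Ω => Y (((p.1 : ℝ) + 1) / ((n : ℝ) + 1)) p.2 :=
      measurable_from_prod_countable_right fun j => hm (((j : ℝ) + 1) / ((n : ℝ) + 1)) (by positivity)
    have h2 : Measurable fun p : ℝ × Ω => (⌊((n : ℝ) + 1) * p.1⌋₊, p.2) :=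
      (Nat.measurable_floor.comp (measurable_const.mul measurable_fst)).prodMk measurable_snd
    exact (h1.comp h2).aestronglyMeasurable
  · have h1 : ∀ᵐ p ∂((volume.restrict (Set.Ioc 0 T)).prod P), p.1 ∈ Set.Ioc 0 T :=
      Measure.quasiMeasurePreserving_fst.ae (ae_restrict_mem measurableSet_Ioc)
    have h2 := (Measure.quasiMeasurePreserving_snd
      (μ := volume.restrict (Set.Ioc (0 : ℝ) T)) (ν := P)).ae hc
    filter_upwards [h1, h2] with p hp1 hp2
    exact (hp2 p.1 hp1.1.le).tendsto.comp (tendsto_gridPoint hp1.1.le)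

variable [SFinite P]

/-- Fubini for the mean of a Volterra integral of a dominated process. -/
lemma integral_volterra_comm {Φ : ℝ → Ω → ℝ} {k : ℝ → ℝ} {H : Ω → ℝ} {t : ℝ} (ht : 0 ≤ t)
    (hk : IntegrableOn k (Set.Ioc 0 t))
    (hΦ : AEStronglyMeasurable (Function.uncurry Φ) ((volume.restrict (Set.Ioc 0 t)).prod P))
    (hH : Integrable H P) (hb : ∀ᵐ w ∂P, ∀ u ∈ Set.Ioc 0 t, |Φ u w| ≤ H w) :
    ∫ w, (∫ u in (0 : ℝ)..t, k u * Φ u w) ∂P = ∫ u in (0 : ℝ)..t, k u * ∫ w, Φ u w ∂P := by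
  have hint : Integrable (Function.uncurry fun u w => k u * Φ u w)
      ((volume.restrict (Set.Ioc 0 t)).prod P) := by
    refine Integrable.mono' (hk.norm.mul_prod hH) (hk.aestronglyMeasurable.comp_fst.mul hΦ) ?_
    have h1 : ∀ᵐ p ∂((volume.restrict (Set.Ioc 0 t)).prod P), p.1 ∈ Set.Ioc 0 t :=
      Measure.quasiMeasurePreserving_fst.ae (ae_restrict_mem measurableSet_Ioc)
    have h2 := (Measure.quasiMeasurePreserving_snd
      (μ := volume.restrict (Set.Ioc (0 : ℝ) t)) (ν := P)).ae hb
    filter_upwards [h1, h2] with p hp1 hp2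
    simp only [Function.uncurry, norm_mul]
    exact mul_le_mul_of_nonneg_left (hp2 p.1 hp1) (norm_nonneg _)
  simp only [intervalIntegral.integral_of_le ht]
  rw [← integral_integral_swap hint]
  simp only [integral_const_mul]

end JointMeasurability

/-! ### Moment equations of the scalar relaxation equation -/

section Moments

variable {Ω : Type*} {mΩ : MeasurableSpace Ω} {P : Measure Ω} [IsProbabilityMeasure P]
  {𝓕 : Filtration ℝ mΩ} {α a σ lam : ℝ} {ξ y : ℝ → Ω → ℝ}

lemma LocallyAC.continuousWithinAt_Ici {f : ℝ → ℝ} (hf : LocallyAC f) {t : ℝ} (ht : 0 ≤ t) :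
    ContinuousWithinAt f (Set.Ici t) t := by
  have h := hf.continuousOn (t := t + 1) (by linarith) t ⟨ht, by linarith⟩
  refine (h.mono (s := Set.Icc t (t + 1)) (Set.Icc_subset_Icc_left ht)).mono_of_mem_nhdsWithin ?_
  exact Icc_mem_nhdsGE (by linarith)

/-- Synchronization in mean for the fractional relaxation equation
`D^α y + (a + ξ) y = 0` with dichotomous noise. -/
theorem tendsto_integral_zero_of_fractional_relaxation (hα0 : 0 < α) (hα1 : α ≤ 1) (ha : 0 < a)
    (hσ : 0 < σ) (hlam : 0 < lam) (hstab : σ ^ 2 < a ^ 2 + lam ^ α * a)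
    (hξ : IsTelegraphNoise P 𝓕 σ lam ξ)
    (hym : ∀ t : ℝ, 0 ≤ t → Measurable[𝓕 t] (y t))
    (hyAC : ∀ᵐ w ∂P, LocallyAC fun t => y t w)
    (hyeq : ∀ᵐ w ∂P, ∀ᵐ t ∂(volume.restrict (Set.Ioi (0 : ℝ))),
      caputoDeriv α (fun s => y s w) t + (a + ξ t w) * y t w = 0)
    (hdom : ∀ T : ℝ, 0 < T → ∃ H : Ω → ℝ, Integrable H P ∧
      ∀ᵐ w ∂P, ∀ t ∈ Set.Icc 0 T, |y t w| ≤ H w) :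
    Tendsto (fun t => ∫ w, y t w ∂P) atTop (𝓝 0) := by
  have hym' : ∀ t : ℝ, 0 ≤ t → Measurable (y t) := fun t ht => (hym t ht).mono (𝓕.le t) le_rfl
  have hyi : ∀ t : ℝ, 0 ≤ t → Integrable (y t) P := by
    intro t ht
    obtain ⟨H, hH, hb⟩ := hdom (t + 1) (by linarith)
    refine hH.mono' (hym' t ht).aestronglyMeasurable ?_
    filter_upwards [hb] with w hw
    exact hw t ⟨ht, by linarith⟩
  set Φ : ℝ → Ω → ℝ := fun t w => (a + ξ t w) * y t w with hΦ
  have hΦm : ∀ t : ℝ, 0 ≤ t → Measurable[𝓕 t] (Φ t) := fun t ht =>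
    ((hξ.adapted t ht).const_add a).mul (hym t ht)
  have hξy : ∀ t, 0 ≤ t → Integrable (fun w => ξ t w * y t w) P := fun t ht =>
    hξ.integrable_mul hσ ht (hyi t ht)
  have hΦi : ∀ t : ℝ, 0 ≤ t → Integrable (Φ t) P := fun t ht => by
    refine (((hyi t ht).const_mul a).add (hξy t ht)).congr (Eventually.of_forall fun w => ?_)
    simp only [hΦ, Pi.add_apply]; ring
  have hjy : ∀ T, AEStronglyMeasurable (Function.uncurry y) ((volume.restrict (Set.Ioc 0 T)).prod P) :=
    aestronglyMeasurable_uncurry_of_rightContinuous hym'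
      (hyAC.mono fun w hw t ht => hw.continuousWithinAt_Ici ht)
  have hjξ : ∀ T, AEStronglyMeasurable (Function.uncurry ξ) ((volume.restrict (Set.Ioc 0 T)).prod P) :=
    aestronglyMeasurable_uncurry_of_rightContinuous (fun t ht => hξ.measurable ht)
      (Eventually.of_forall fun w t ht => hξ.rightContinuous w t ht)
  have hjΦ : ∀ T, AEStronglyMeasurable (Function.uncurry Φ) ((volume.restrict (Set.Ioc 0 T)).prod P) :=
    fun T => ((hjξ T).const_add a).mul (hjy T)
  have hΦb : ∀ T : ℝ, 0 < T → ∃ H : Ω → ℝ, Integrable H P ∧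
      ∀ᵐ w ∂P, ∀ t ∈ Set.Icc 0 T, |Φ t w| ≤ H w := by
    intro T hT
    obtain ⟨H, hH, hb⟩ := hdom T hT
    refine ⟨fun w => (a + σ) * H w, hH.const_mul _, ?_⟩
    filter_upwards [hb] with w hw t ht
    simp only [hΦ, abs_mul]
    refine mul_le_mul ((abs_add_le _ _).trans ?_) (hw t ht) (abs_nonneg _) (by positivity)
    rw [abs_of_pos ha, hξ.abs_eq hσ ht.1]
  -- One null set serves all `t`, so the identity may be multiplied by `ξ t` and averaged at each
  -- time.
  have hint : ∀ᵐ w ∂P, ∀ t, 0 ≤ t →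
      y t w = y 0 w - ∫ u in (0 : ℝ)..t, fracKernel α (t - u) * Φ u w := by
    filter_upwards [hyAC, hyeq] with w hw hweq t ht
    have h := hw.integral_fracKernel_mul_caputoDeriv hα0 hα1 ht
    have h1 : ∫ u in (0 : ℝ)..t, fracKernel α (t - u) * caputoDeriv α (fun s => y s w) u
        = ∫ u in (0 : ℝ)..t, -(fracKernel α (t - u) * Φ u w) := by
      refine intervalIntegral.integral_congr_ae ?_
      rw [ae_restrict_iff' measurableSet_Ioi] at hweq
      filter_upwards [hweq] with u hu hut
      rw [Set.uIoc_of_le ht] at hut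
      rw [eq_neg_of_add_eq_zero_left (hu hut.1), mul_neg]
    rw [h1, intervalIntegral.integral_neg] at h
    linarith
  have hk : ∀ t, 0 < t → IntegrableOn (fun u => fracKernel α (t - u)) (Set.Ioc 0 t) := fun t ht => by
    rw [← intervalIntegrable_iff_integrableOn_Ioc_of_le ht.le]
    simpa using ((intervalIntegrable_fracKernel hα0 ht).comp_sub_left t).symm
  refine tendsto_zero_of_moment_system (q := fun t => ∫ w, ξ t w * y t w ∂P) (v := σ ^ 2)
    hα0 hα1 ha hlam (sq_nonneg σ) hstab (fun t _ => (hjy t).integral_prod_right')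
    (fun t _ => ((hjξ t).mul (hjy t)).integral_prod_right') (fun T hT => ?_) (fun T hT => ?_)
    (fun t ht => ?_) (fun t ht => ?_)
  · obtain ⟨H, hH, hb⟩ := hdom T hT
    refine ⟨∫ w, H w ∂P, fun s hs => ?_⟩
    rw [← Real.norm_eq_abs]
    exact norm_integral_le_of_norm_le hH (hb.mono fun w hw => hw s hs)
  · obtain ⟨H, hH, hb⟩ := hdom T hT
    refine ⟨∫ w, σ * H w ∂P, fun s hs => ?_⟩
    rw [← Real.norm_eq_abs]
    refine norm_integral_le_of_norm_le (hH.const_mul σ) (hb.mono fun w hw => ?_)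
    rw [Real.norm_eq_abs, abs_mul, hξ.abs_eq hσ hs.1]
    exact mul_le_mul_of_nonneg_left (hw s hs) hσ.le
  · rcases ht.eq_or_lt with rfl | ht
    · simp
    obtain ⟨H, hH, hb⟩ := hΦb t ht
    have hfub := integral_volterra_comm ht.le (hk t ht) (hjΦ t) hH
      (hb.mono fun w hw u hu => hw u (Set.Ioc_subset_Icc_self hu))
    have h1 : ∫ w, (y 0 w - y t w) ∂P
        = ∫ w, (∫ u in (0 : ℝ)..t, fracKernel α (t - u) * Φ u w) ∂P := by
      refine integral_congr_ae (hint.mono fun w hw => ?_)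
      simp only
      linarith [hw t ht.le]
    rw [integral_sub (hyi 0 le_rfl) (hyi t ht.le), hfub] at h1
    have h2 : ∫ u in (0 : ℝ)..t, fracKernel α (t - u) * ∫ w, Φ u w ∂P
        = ∫ u in (0 : ℝ)..t, fracKernel α (t - u) *
          (a * (∫ w, y u w ∂P) + ∫ w, ξ u w * y u w ∂P) := by
      refine intervalIntegral.integral_congr fun u hu => ?_
      rw [Set.uIcc_of_le ht.le] at hu
      simp only [hΦ, add_mul]
      rw [integral_add ((hyi u hu.1).const_mul a) (hξy u hu.1), integral_const_mul]
    rw [h2] at h1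
    linarith
  · rcases ht.eq_or_lt with rfl | ht
    · simp
    obtain ⟨H, hH, hb⟩ := hΦb t ht
    have hjξΦ : AEStronglyMeasurable (Function.uncurry fun u w => ξ t w * Φ u w)
        ((volume.restrict (Set.Ioc 0 t)).prod P) :=
      (hξ.measurable ht.le).aestronglyMeasurable.comp_snd.mul (hjΦ t)
    have hfub := integral_volterra_comm ht.le (hk t ht) hjξΦ (hH.const_mul σ)
      (hb.mono fun w hw u hu => by
        rw [abs_mul, hξ.abs_eq hσ ht.le]
        exact mul_le_mul_of_nonneg_left (hw u (Set.Ioc_subset_Icc_self hu)) hσ.le)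
    have h1 : ∫ w, (ξ t w * y 0 w - ξ t w * y t w) ∂P
        = ∫ w, (∫ u in (0 : ℝ)..t, fracKernel α (t - u) * (ξ t w * Φ u w)) ∂P := by
      refine integral_congr_ae (hint.mono fun w hw => ?_)
      have h3 : ∀ u, fracKernel α (t - u) * (ξ t w * Φ u w)
          = ξ t w * (fracKernel α (t - u) * Φ u w) := fun u => by ring
      simp only [h3, intervalIntegral.integral_const_mul]
      rw [hw t ht.le]; ring
    rw [integral_sub (hξ.integrable_mul hσ ht.le (hyi 0 le_rfl)) (hξy t ht.le), hfub,
      hξ.integral_mul hσ le_rfl ht.le (hym 0 le_rfl) (hyi 0 le_rfl), sub_zero] at h1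
    have h2 : ∫ u in (0 : ℝ)..t, fracKernel α (t - u) * ∫ w, ξ t w * Φ u w ∂P
        = ∫ u in (0 : ℝ)..t, Real.exp (-(lam * (t - u))) * fracKernel α (t - u) *
          (a * (∫ w, ξ u w * y u w ∂P) + σ ^ 2 * ∫ w, y u w ∂P) := by
      refine intervalIntegral.integral_congr fun u hu => ?_
      rw [Set.uIcc_of_le ht.le] at hu
      have h3 : ∫ w, ξ u w * Φ u w ∂P
          = a * (∫ w, ξ u w * y u w ∂P) + σ ^ 2 * ∫ w, y u w ∂P := by
        rw [← integral_const_mul, ← integral_const_mul,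
          ← integral_add ((hξy u hu.1).const_mul a) ((hyi u hu.1).const_mul _)]
        refine integral_congr_ae (Eventually.of_forall fun w => ?_)
        have := hξ.mul_self hu.1 w
        simp only [hΦ]
        linear_combination y u w * this
      -- Since `Φ u` is measurable with respect to the past up to `u`, the noise can be moved from
      -- `t` back to `u`, producing the tempering factor.
      rw [hξ.integral_mul hσ hu.1 hu.2 (hΦm u hu.1) (hΦi u hu.1), h3]
      ring
    rw [h2] at h1
    linarith

end Moments

/-! ### Application to the star system -/

section Star

variable {Ω : Type*} {mΩ : MeasurableSpace Ω} {P : Measure Ω}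
  {𝓕 : Filtration ℝ mΩ} {α ω ε A ν σ lam : ℝ} {N : ℕ} {ξ : ℝ → Ω → ℝ} {x : Fin (N + 1) → ℝ → Ω → ℝ}

lemma IsStarSolution.deviation_eq (hx : IsStarSolution P 𝓕 α ω ε A ν ξ N x) (hα0 : 0 < α)
    (hα1 : α ≤ 1) :
    ∀ᵐ w ∂P, LocallyAC (fun t => mainDeviation x t w) ∧
      ∀ᵐ t ∂(volume.restrict (Set.Ioi (0 : ℝ))),
        caputoDeriv α (fun s => mainDeviation x s w) t
          + (ω + ξ t w + ε * ((N : ℝ) + 1)) * mainDeviation x t w = 0 := by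
  filter_upwards [hx.locallyAC, hx.main_eq, hx.general_eq] with w hAC hmain hgen
  have h := ae_caputoDeriv_deviation (X := fun i t => x i t w) (z := fun t => ξ t w)
    hα0 hα1 hAC hmain hgen
  simp only [mainDeviation, meanField]
  exact ⟨LocallyAC.deviation (X := fun i t => x i t w) hAC, h⟩

/-- The particles of a solution are dominated on bounded time intervals by an integrable random
variable. -/
lemma IsStarSolution.exists_dominating [IsProbabilityMeasure P]
    (hx : IsStarSolution P 𝓕 α ω ε A ν ξ N x)
    (hα0 : 0 < α) (hα1 : α ≤ 1) (hω : 0 ≤ ω) (hσ : 0 < σ) (hξ : IsTelegraphNoise P 𝓕 σ lam ξ)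
    (hx0 : ∀ i : Fin (N + 1), Integrable (x i 0) P) {T : ℝ} (hT : 0 < T) :
    ∃ H : Ω → ℝ, Integrable H P ∧ ∀ᵐ w ∂P, ∀ t ∈ Set.Icc 0 T, ∑ i, |x i t w| ≤ H w := by
  obtain ⟨G, -, hG⟩ := exists_star_path_bound hα0 hα1 hω hσ ε A N hT
  refine ⟨fun w => G * (∑ i, |x i 0 w| + 1),
    ((integrable_finsetSum _ fun i _ => (hx0 i).abs).add (integrable_const _)).const_mul G, ?_⟩
  filter_upwards [hx.locallyAC, hx.main_eq, hx.general_eq] with w hAC hmain hgen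
  exact hG (fun i t => x i t w) hAC fun i =>
    abs_caputoDeriv_le_of_star (X := fun i t => x i t w) (z := fun t => ξ t w) hω
      (fun t ht => (hξ.abs_eq hσ ht w).le) hmain hgen i

lemma IsStarSolution.integrable [IsProbabilityMeasure P]
    (hx : IsStarSolution P 𝓕 α ω ε A ν ξ N x)
    (hα0 : 0 < α) (hα1 : α ≤ 1) (hω : 0 ≤ ω) (hσ : 0 < σ) (hξ : IsTelegraphNoise P 𝓕 σ lam ξ)
    (hx0 : ∀ i : Fin (N + 1), Integrable (x i 0) P) {t : ℝ} (ht : 0 ≤ t) (i : Fin (N + 1)) :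
    Integrable (x i t) P := by
  obtain ⟨H, hH, hb⟩ := hx.exists_dominating hα0 hα1 hω hσ hξ hx0 (T := t + 1) (by linarith)
  refine hH.mono' ((hx.adapted i t ht).mono (𝓕.le t) le_rfl).aestronglyMeasurable ?_
  filter_upwards [hb] with w hw
  exact (Finset.single_le_sum (f := fun j => |x j t w|) (fun _ _ => abs_nonneg _)
    (Finset.mem_univ i)).trans (hw t ⟨ht, by linarith⟩)

lemma abs_mainDeviation_le (t : ℝ) (w : Ω) : |mainDeviation x t w| ≤ 2 * ∑ i, |x i t w| := by
  have h1 : |x 0 t w| ≤ ∑ i, |x i t w| :=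
    Finset.single_le_sum (f := fun j => |x j t w|) (fun _ _ => abs_nonneg _) (Finset.mem_univ 0)
  have h2 : |meanField x t w| ≤ ∑ i, |x i t w| := by
    rw [meanField, abs_div, abs_of_pos (by positivity : (0 : ℝ) < N + 1)]
    refine (div_le_self (abs_nonneg _) ?_).trans (Finset.abs_sum_le_sum_abs _ _)
    linarith [Nat.cast_nonneg (α := ℝ) N]
  rw [mainDeviation]
  refine (abs_sub _ _).trans ?_
  linarith

end Star

theorem mainTheorem3 {Ω : Type*} {mΩ : MeasurableSpace Ω} (P : Measure Ω)
    [IsProbabilityMeasure P] (𝓕 : Filtration ℝ mΩ)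
    (α ω ε A ν σ lam : ℝ) (N : ℕ)
    (hα0 : 0 < α) (hα1 : α ≤ 1) (hω : 0 ≤ ω) (hσ : 0 < σ) (hlam : 0 < lam)
    (ξ : ℝ → Ω → ℝ) (hξ : IsTelegraphNoise P 𝓕 σ lam ξ)
    (x : Fin (N + 1) → ℝ → Ω → ℝ) (hx : IsStarSolution P 𝓕 α ω ε A ν ξ N x)
    (hx0 : ∀ i : Fin (N + 1), Integrable (x i 0) P) :
    (∀ᵐ w ∂P, LocallyAC (fun t => mainDeviation x t w) ∧
      ∀ᵐ t ∂(volume.restrict (Set.Ioi (0 : ℝ))),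
        caputoDeriv α (fun s => mainDeviation x s w) t
          + (ω + ξ t w + ε * ((N : ℝ) + 1)) * mainDeviation x t w = 0) ∧
    (∀ t : ℝ, 0 ≤ t →
      Integrable (x 0 t) P ∧ Integrable (meanField x t) P ∧ Integrable (mainDeviation x t) P) ∧
    (0 < ω + ε * ((N : ℝ) + 1) →
      σ ^ 2 < (ω + ε * ((N : ℝ) + 1)) ^ 2 + lam ^ α * (ω + ε * ((N : ℝ) + 1)) →
      Tendsto (fun t : ℝ => ∫ w, mainDeviation x t w ∂P) atTop (𝓝 0)) := by
  have hdev := hx.deviation_eq hα0 hα1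
  refine ⟨hdev, fun t ht => ?_, fun ha hstab => ?_⟩
  · have hi := fun i => hx.integrable hα0 hα1 hω hσ hξ hx0 ht i
    have hS : Integrable (meanField x t) P :=
      (integrable_finsetSum Finset.univ fun i _ => hi i).div_const _
    exact ⟨hi 0, hS, (hi 0).sub hS⟩
  · refine tendsto_integral_zero_of_fractional_relaxation hα0 hα1 ha hσ hlam hstab hξ ?_
      (hdev.mono fun w hw => hw.1) ?_ fun T hT => ?_
    · intro t ht
      have hm := fun i => hx.adapted i t ht
      exact (hm 0).sub ((Finset.measurable_fun_sum _ fun i _ => hm i).div_const _)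
    · filter_upwards [hdev] with w hw
      filter_upwards [hw.2] with t ht
      rw [← ht]; ring
    · obtain ⟨H, hH, hb⟩ := hx.exists_dominating hα0 hα1 hω hσ hξ hx0 hT
      refine ⟨fun w => 2 * H w, hH.const_mul 2, ?_⟩
      filter_upwards [hb] with w hw t ht
      exact (abs_mainDeviation_le t w).trans (by linarith [hw t ht])
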